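/- A graph is \emph{median} if it is connected and $I(x,y)\cap I(y,z)\cap I(z,x)$ is a singleton for all vertices $x,y,z$, where $I(u,v)$ is the set of vertices on shortest $(u,v)$-paths. Its edges $xy$ and $zw$ are $\Theta$-related if $d(x,z)+d(y,w)\neq d(x,w)+d(y,z)$; in a median graph this is an equivalence relation. Two classes \emph{cross} if some 4-cycle has two opposite edges in each of them. The \emph{carrier} of a class is the union of all cubes having an edge in it, and the \emph{contact graph} has the $\Theta$-classes as vertices, two distinct classes being adjacent when their carriers intersect. Pointing the graph at $\alpha$ directs each edge away from $\alpha$; in the \emph{pointed contact graph} two distinct $\Theta$-classes are adjacent when they cross or contain two directed edges with a common origin that do not lie in a common square. The \emph{associated event structure} $\mathcal E_\alpha$ has the $\Theta$-classes as events; $\Theta_i\le\Theta_j$ if $\Theta_i=\Theta_j$ or $\Theta_i$ separates $\alpha$ from $\Theta_j$ (they do not cross and all edges of $\Theta_j$ lie in the halfspace of $\Theta_i$ not containing $\alpha$); distinct classes are in conflict if they do not cross and neither separates $\alpha$ from the other. Two events of an event structure are \emph{independent} if they are concurrent (incomparable and not in conflict) or in minimal conflict; the \emph{degree} is the supremum of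 the sizes of sets of pairwise independent events, and a \emph{nice labeling} gives different labels to independent events. The \emph{domain} is the set of conflict-free downward-closed sets of events, ordered by inclusion. The \emph{Burling sequence} $(G_k,\mathcal S_k)_{k\ge0}$ starts with the one-vertex graph and $\mathcal S_0=\{V(G_0)\}$. To get $G_{k+1}$, take a master copy of $G_k$, for each $S\in\mathcal S_k$ of the master copy a new copy $H_S$ of $G_k$, and for each $T\in\mathcal S_k$ of $H_S$ a new vertex $v_{S,T}$ adjacent exactly to the vertices of $T$ in $H_S$; $\mathcal S_{k+1}$ consists of all sets $S\cup T$ and $S\cup\{v_{S,T}\}$. Given a finite family $B_1,\dots,B_m$ of closed axis-parallel boxes (with nonempty interior) in the open first octant of $\mathbb R^3$ and a box $B_0=[0,L_1]\times[0,L_2]\times[0,L_3]$ containing them, subdivide $B_0$ into elementary cells by the axis-parallel planes through the corners of the $B_i$. In $\mathbb R^m\times\mathbb R^3$ take all cells $\{0\}\times C$ and, for every $i$ and every elementary cell $C\subseteq B_i$, the cell $s_i\times C$, where $s_i$ is the unit segment of the $i$-th axis of $\mathbb R^m$. The \emph{lifted graph} is the 1-skeleton of this box complex. \textbf{Proposition.}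 For every integer $n>0$ there is a finite family $\mathcal B(n)$ of axis-parallel boxes in the open first octant of $\mathbb R^3$ whose intersection graph is isomorphic to the Burling graph $G_n$, which has clique number $2$ and chromatic number greater than $n$, and such that for every box $B_0$ as above containing $\mathcal B(n)$ the lifted graph $\widetilde G(n)$ has the following properties. 1. $\widetilde G(n)$ is a finite median graph of maximum degree exactly $8$, and the chromatic number of its contact graph is greater than $n$. 2. The origin $\alpha_n$ is a vertex of $\widetilde G(n)$. The pointed graph $\widetilde G_{\alpha_n}(n)$ has maximum out-degree exactly $5$, and the chromatic number of its pointed contact graph is greater than $n$. 3. The associated $\mathcal E_{\alpha_n}$ is a finite event structure of degree $5$, the Hasse diagram of its domain is isomorphic to the directed graph $\widetilde G_{\alpha_n}(n)$, and every nice labeling of it uses more than $n$ labels. -/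

import Mathlib

/-! ## Median graphs, parallelism classes, contact graphs -/

namespace SimpleGraph

variable {V : Type*} (G : SimpleGraph V)

/-- The interval `I(u, v)`: all vertices lying on shortest `(u, v)`-paths. -/
def interval (u v : V) : Set V :=
  {x | G.dist u x + G.dist x v = G.dist u v}

/-- A median graph: connected, and `I(x,y) ∩ I(y,z) ∩ I(z,x)` is a singleton for all `x, y, z`. -/
def IsMedian : Prop :=
  G.Connected ∧ ∀ x y z : V, ∃! w : V, w ∈ G.interval x y ∩ G.interval y z ∩ G.interval z x

/-- The directed edges of the graph `G` pointed at `α`: an edge `uv` is directed from `u` to `v`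
when `d(α, u) < d(α, v)`. -/
def PointedArc (α u v : V) : Prop :=
  G.Adj u v ∧ G.dist α u < G.dist α v

/-- The Djokovic-Winkler relation `Θ` on the edges: `xy Θ zw` when
`d(x,z) + d(y,w) ≠ d(x,w) + d(y,z)`.
The condition does not depend on the order in which the ends of the two edges are listed. -/
def ThetaRel (e f : G.edgeSet) : Prop :=
  ∃ x y z w : V, (e : Sym2 V) = s(x, y) ∧ (f : Sym2 V) = s(z, w) ∧
    G.dist x z + G.dist y w ≠ G.dist x w + G.dist y z

/-- The classes of the relation `Θ`. `Quot` takes classes of the equivalence relation generated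
by `Θ`; in a median graph `Θ` is already an equivalence relation, and these are its classes. -/
def ThetaClass : Type _ := Quot G.ThetaRel

variable {G} in
/-- `xy` is an edge belonging to the class `i`. -/
def ThetaClass.Has (i : G.ThetaClass) (x y : V) : Prop :=
  ∃ h : G.Adj x y, (Quot.mk _ (⟨s(x, y), h⟩ : G.edgeSet) : G.ThetaClass) = i

/-- `a b c d` is a 4-cycle (a square) of `G`. -/
def IsSquare (a b c d : V) : Prop :=
  G.Adj a b ∧ G.Adj b c ∧ G.Adj c d ∧ G.Adj d a ∧ a ≠ c ∧ b ≠ d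

/-- Two classes cross: some 4-cycle has two opposite edges in the first and the other two opposite
edges in the second. -/
def Cross (i j : G.ThetaClass) : Prop :=
  ∃ a b c d : V, G.IsSquare a b c d ∧ i.Has a b ∧ i.Has c d ∧ j.Has b c ∧ j.Has d a

/-- The `k`-dimensional hypercube graph. -/
def cube (k : ℕ) : SimpleGraph (Fin k → Bool) where
  Adj u v := hammingDist u v = 1
  symm := ⟨fun u v h => by rw [hammingDist_comm]; exact h⟩
  loopless := ⟨fun u h => by simp at h⟩

/-- The vertices of the carrier of the hyperplane of the class `i`: the vertices of all cubes
of `G` that have an edge in `i`. -/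
def carrier (i : G.ThetaClass) : Set V :=
  {v | ∃ (k : ℕ) (φ : cube k ↪g G), v ∈ Set.range φ ∧ ∃ a b, i.Has (φ a) (φ b)}

/-- The contact graph: two classes (hyperplanes) are adjacent when their carriers intersect.
(Carriers are unions of cubes of the cubical complex of `G`; two cubes of the complex meet exactly
when they share a vertex.) -/
def contactGraph : SimpleGraph G.ThetaClass where
  Adj i j := i ≠ j ∧ (G.carrier i ∩ G.carrier j).Nonempty
  symm := ⟨fun i j h => ⟨h.1.symm, by rw [Set.inter_comm]; exact h.2⟩⟩
  loopless := ⟨fun i h => h.1 rfl⟩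

/-- Two classes osculate in directed edges `oa`, `ob` of `G` pointed at `α`, of common origin `o`:
these two edges do not belong to a common square. -/
def OutOsculate (α : V) (i j : G.ThetaClass) : Prop :=
  ∃ o a b : V, G.PointedArc α o a ∧ G.PointedArc α o b ∧ i.Has o a ∧ j.Has o b ∧
    ¬ ∃ c, G.IsSquare o a c b

/-- The pointed contact graph: two classes are adjacent when they cross, or osculate in two
directed edges with a common origin. -/
def pointedContactGraph (α : V) : SimpleGraph G.ThetaClass where
  Adj i j := i ≠ j ∧ (G.Cross i j ∨ G.OutOsculate α i j)
  symm := ⟨by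
    rintro i j ⟨hne, h | h⟩
    · obtain ⟨a, b, c, d, ⟨h1, h2, h3, h4, h5, h6⟩, hab, hcd, hbc, hda⟩ := h
      exact ⟨hne.symm, Or.inl ⟨b, c, d, a, ⟨h2, h3, h4, h1, h6, h5.symm⟩, hbc, hda, hcd, hab⟩⟩
    · obtain ⟨o, a, b, ha, hb, hia, hjb, hn⟩ := h
      refine ⟨hne.symm, Or.inr ⟨o, b, a, hb, ha, hjb, hia, ?_⟩⟩
      rintro ⟨c, h1, h2, h3, h4, h5, h6⟩
      exact hn ⟨c, h4.symm, h3.symm, h2.symm, h1.symm, h5, h6.symm⟩⟩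
  loopless := ⟨fun i h => h.1 rfl⟩

/-- The halfspace of the class `i` that does not contain the basepoint `α`: for an edge `xy` of
`i` directed from `x` to `y`, it is `W(y, x)`, the set of vertices closer to `y` than to `x`. -/
def farHalfspace (α : V) (i : G.ThetaClass) : Set V :=
  {z | ∃ x y : V, G.PointedArc α x y ∧ i.Has x y ∧ G.dist z y < G.dist z x}

/-- The class `i` separates the basepoint `α` from the class `j`: they do not cross and
all edges of `j` lie in the halfspace of `i` not containing `α`. -/
def Separates (α : V) (i j : G.ThetaClass) : Prop :=
  ¬ G.Cross i j ∧ ∀ x y : V, j.Has x y → x ∈ G.farHalfspace α i ∧ y ∈ G.farHalfspace α i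

end SimpleGraph

/-! ## Event structures -/

/-- An event structure (with binary conflict and finitary causal dependency) on a set of events. -/
structure EventStructure (E : Type*) extends PartialOrder E where
  conflict : E → E → Prop
  conflict_irrefl : ∀ e, ¬ conflict e e
  conflict_symm : ∀ e e', conflict e e' → conflict e' e
  conflict_hered : ∀ e e' e'', conflict e e' → le e' e'' → conflict e e''
  finitary : ∀ e, {e' | le e' e}.Finite

namespace EventStructure

variable {E : Type*} (𝓔 : EventStructure E)

/-- Concurrent events: order-incomparable and not in conflict. -/
def Concurrent (e e' : E) : Prop :=
  ¬ 𝓔.le e e' ∧ ¬ 𝓔.le e' e ∧ ¬ 𝓔.conflict e e'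

/-- Minimal conflict. -/
def MinimalConflict (e' e'' : E) : Prop :=
  𝓔.conflict e' e'' ∧
    ¬ ∃ e, e ≠ e' ∧ e ≠ e'' ∧
      ((𝓔.le e e' ∧ 𝓔.conflict e e'') ∨ (𝓔.le e e'' ∧ 𝓔.conflict e e'))

/-- Independent (orthogonal) events. -/
def Independent (e e' : E) : Prop :=
  𝓔.Concurrent e e' ∨ 𝓔.MinimalConflict e e'

/-- The degree: the least upper bound of the sizes of the independent sets. -/
noncomputable def degree : ℕ∞ :=
  sSup {k | ∃ s : Set E, s.Pairwise 𝓔.Independent ∧ s.encard = k}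

/-- A nice labeling: independent events have different labels. -/
def IsNiceLabeling {L : Type*} (lab : E → L) : Prop :=
  ∀ e e', 𝓔.Independent e e' → lab e ≠ lab e'

/-- Configurations: conflict-free downward-closed sets of events. -/
def IsConfiguration (C : Set E) : Prop :=
  (∀ e ∈ C, ∀ e' ∈ C, ¬ 𝓔.conflict e e') ∧ ∀ e ∈ C, ∀ e', 𝓔.le e' e → e' ∈ C

/-- The domain: the configurations, ordered by inclusion. -/
abbrev Domain : Type _ := {C : Set E // 𝓔.IsConfiguration C}

/-- `𝓔` is the event structure associated with the graph `G` pointed at `α`: its events are the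
`Θ`-classes, `i ≤ j` when `i = j` or `i` separates `α` from `j`, and distinct `i`, `j` are in
conflict when they do not cross and neither separates `α` from the other. -/
def IsAssociated {V : Type*} (G : SimpleGraph V) (α : V)
    (𝓔 : EventStructure G.ThetaClass) : Prop :=
  (∀ i j, 𝓔.le i j ↔ i = j ∨ G.Separates α i j) ∧
  ∀ i j, 𝓔.conflict i j ↔
    i ≠ j ∧ ¬ G.Cross i j ∧ ¬ G.Separates α i j ∧ ¬ G.Separates α j i

end EventStructure

/-! ## Burling's construction -/

/-- A graph together with an indexed family of sets of vertices. -/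
structure GraphWithSets where
  V : Type
  graph : SimpleGraph V
  Idx : Type
  set : Idx → Set V

namespace GraphWithSets

/-- The vertices of the next Burling graph: a master copy of `X`, a copy of `X` for each
set `S` of the master copy, and a vertex `v S T` for each such `S` and each set `T` of its copy. -/
inductive NextV (X : GraphWithSets) : Type
  | master (u : X.V)
  | copy (S : X.Idx) (u : X.V)
  | new (S T : X.Idx)

/-- Adjacency in the next Burling graph: edges inside the copies of `X`, and `v S T` is joined to
the vertices of the set `T` of the copy of index `S`. -/
inductive NextAdj (X : GraphWithSets) : X.NextV → X.NextV → Prop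
  | master {u w : X.V} (h : X.graph.Adj u w) : NextAdj X (.master u) (.master w)
  | copy (S : X.Idx) {u w : X.V} (h : X.graph.Adj u w) : NextAdj X (.copy S u) (.copy S w)
  | copy_new (S T : X.Idx) {u : X.V} (h : u ∈ X.set T) : NextAdj X (.copy S u) (.new S T)
  | new_copy (S T : X.Idx) {u : X.V} (h : u ∈ X.set T) : NextAdj X (.new S T) (.copy S u)

/-- One step of Burling's construction. The new sets are `S ∪ T` and `S ∪ {v S T}`, for each set
`S` of the master copy and each set `T` of the copy of index `S`. -/
def next (X : GraphWithSets) : GraphWithSets where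
  V := X.NextV
  graph :=
    { Adj := X.NextAdj
      symm := ⟨by
        rintro _ _ (h | ⟨S, h⟩ | ⟨S, T, h⟩ | ⟨S, T, h⟩)
        · exact .master h.symm
        · exact .copy S h.symm
        · exact .new_copy S T h
        · exact .copy_new S T h⟩
      loopless := ⟨by
        rintro _ (h | ⟨S, h⟩)
        · exact X.graph.loopless.irrefl _ h
        · exact X.graph.loopless.irrefl _ h⟩ }
  Idx := (X.Idx × X.Idx) ⊕ (X.Idx × X.Idx)
  set := Sum.elim
    (fun p => (NextV.master '' X.set p.1) ∪ (NextV.copy p.1 '' X.set p.2))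
    (fun p => (NextV.master '' X.set p.1) ∪ {NextV.new p.1 p.2})

/-- The Burling sequence: it starts with one vertex, whose singleton is the only chosen set. -/
def burling : ℕ → GraphWithSets
  | 0 => { V := Unit, graph := ⊥, Idx := Unit, set := fun _ => Set.univ }
  | n + 1 => (burling n).next

end GraphWithSets

/-! ## Families of boxes and the lifting procedure -/

/-- The intersection graph of a family of (closed) boxes in `ℝ³`. -/
def intersectionGraph {m : ℕ} (B : Fin m → BoxIntegral.Box (Fin 3)) : SimpleGraph (Fin m) where
  Adj i j := i ≠ j ∧
    (Set.Icc (B i).lower (B i).upper ∩ Set.Icc (B j).lower (B j).upper).Nonempty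
  symm := ⟨fun i j h => ⟨h.1.symm, by rw [Set.inter_comm]; exact h.2⟩⟩
  loopless := ⟨fun i h => h.1 rfl⟩

namespace BoxComplex

/-- A cell of a box complex in `ℝ^κ`: a possibly degenerate box, product of the intervals
`[lo k, hi k]`. -/
structure Cell (κ : Type) where
  lo : κ → ℝ
  hi : κ → ℝ

/-- The corners of a cell. -/
def Cell.IsCorner {κ : Type} (c : Cell κ) (p : κ → ℝ) : Prop :=
  ∀ k, p k = c.lo k ∨ p k = c.hi k

/-- The vertices of a collection of cells: the corners of the cells. -/
def Vertex {κ : Type} (K : Set (Cell κ)) : Type :=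
  {p : κ → ℝ // ∃ c ∈ K, c.IsCorner p}

/-- The 1-skeleton of the box complex generated by a collection of cells: two vertices are adjacent
when they are the ends of an edge of some cell, that is, corners of this cell differing in exactly
one coordinate. -/
def skeleton {κ : Type} (K : Set (Cell κ)) : SimpleGraph (Vertex K) where
  Adj p q := (∃ c ∈ K, c.IsCorner p.1 ∧ c.IsCorner q.1) ∧ ∃! k, p.1 k ≠ q.1 k
  symm := ⟨by
    rintro p q ⟨⟨c, hc, hp, hq⟩, h⟩
    exact ⟨⟨c, hc, hq, hp⟩, by simpa only [ne_comm] using h⟩⟩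
  loopless := ⟨fun p h => by
    obtain ⟨k, hk, _⟩ := h.2
    exact hk rfl⟩

variable {m : ℕ} (B : Fin m → BoxIntegral.Box (Fin 3)) (L : Fin 3 → ℝ)

/-- The values `x` for which the plane `p k = x` is used in the subdivision of
`B₀ = [0, L 0] × [0, L 1] × [0, L 2]`: the two faces of `B₀`, and the planes through the corners of
the boxes of the family. -/
def cuts (k : Fin 3) : Set ℝ :=
  {0, L k} ∪ Set.range (fun i => (B i).lower k) ∪ Set.range (fun i => (B i).upper k)

/-- `c` is an elementary cell of the subdivision of `B₀`: in each direction it is bounded by two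
consecutive planes. -/
def IsElementary (c : Cell (Fin 3)) : Prop :=
  ∀ k, c.lo k ∈ cuts B L k ∧ c.hi k ∈ cuts B L k ∧ c.lo k < c.hi k ∧
    ∀ x ∈ cuts B L k, ¬ (c.lo k < x ∧ x < c.hi k)

/-- A cell of `ℝ³`, seen in `ℝ^m × ℝ³` (with first `m` coordinates equal to `0`). -/
def embed (c : Cell (Fin 3)) : Cell (Fin m ⊕ Fin 3) where
  lo := Sum.elim (fun _ => 0) c.lo
  hi := Sum.elim (fun _ => 0) c.hi

/-- The product of a cell of `ℝ³` with the unit segment of the `i`-th axis of `ℝ^m`. -/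
def liftCell (i : Fin m) (c : Cell (Fin 3)) : Cell (Fin m ⊕ Fin 3) where
  lo := Sum.elim (fun _ => 0) c.lo
  hi := Sum.elim (fun j => if j = i then 1 else 0) c.hi

/-- The lifted box complex in `ℝ^m × ℝ³`: the elementary cells, and for each box `B i` and each
elementary cell contained in it, the product of this cell with the unit segment of the `i`-th
axis. -/
def liftedComplex : Set (Cell (Fin m ⊕ Fin 3)) :=
  {d | ∃ c, IsElementary B L c ∧
    (d = embed c ∨
      ∃ i, Set.Icc c.lo c.hi ⊆ Set.Icc (B i).lower (B i).upper ∧ d = liftCell i c)}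

/-- The lifted graph: the 1-skeleton of the lifted box complex. -/
def liftedGraph : SimpleGraph (Vertex (liftedComplex B L)) :=
  skeleton (liftedComplex B L)

end BoxComplex

/-!
The boxes. The Burling graph `G (k + 1)` is represented by boxes inside any given box together
with a *root* for each of the chosen sets `S`: a box whose *probe*, a half-infinite beam going
forward in the first coordinate and downward in the third one, meets exactly the boxes of the
elements of `S`, all of them behind the root. Given such a representation of the master copy of
`G k`, the copy of index `S` is represented in the upper half of the root of `S`, and the box of the
new vertex of `S` and `T` is put in the first half (in the second coordinate) of the probe of `T`,
from which it hangs down below the copy. The probe of `S ∪ T` starts in another part of the root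
of `T`, and the probe of the set containing the new vertex starts before the new box and passes
under the copy; both are contained in the probe of `S` (`BoxRepresentation.next`). That the
Burling graphs have no triangle and a large chromatic number is the classical argument: the chosen
sets are stable, and in any colouring one of them receives many colours
(`GraphWithSets.exists_set_many_colors`).

The lifted graph. Rather than gluing box complexes, the proof describes the lifted graph as the
graph of the domain of an explicit event structure. Its events are the *walls*, one for each plane
of the subdivision other than the coordinate planes, and the boxes. The walls of one direction
form a chain; a wall is below a box when it does not exceed the lower corner of the box, and in
conflict with it when it is beyond the upper corner; any two boxes are in conflict. A
configuration is the same as a vertex: the set of the walls crossed is a grid point, and there may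
be a box containing this point (`BoxComplex.isDomainGraph`).

General facts on a finite event structure then give the rest. In the graph of its domain the
distance is the cardinality of the symmetric difference, so that the majority set of three
configurations is their unique median, the `Θ`-classes are the events, crossing means concurrency,
and separation from the empty configuration means precedence
(`SimpleGraph.IsDomainGraph.isMedian`, `SimpleGraph.IsDomainGraph.isAssociated`). Independent
events can be added to a common configuration, hence are adjacent in both contact graphs. Two
boxes are independent as events exactly when they meet (`BoxComplex.independent_box_iff`), so
colourings of the contact graphs and nice labelings colour the Burling graph. An independent set
has at most one wall per direction and, as there is no triangle, at most two boxes, which gives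
`3 + 2 = 5`; at a vertex one more wall per direction can be removed, which gives `8`. Both bounds are
attained at the smallest common point of two boxes that meet
(`BoxComplex.exists_gridPoint_of_adj`).
-/

/-! ### Burling graphs: triangles and colourings -/

namespace GraphWithSets

/-- A step of Burling's construction preserves finiteness of the vertex set. -/
theorem finite_nextV (X : GraphWithSets) [Finite X.V] [Finite X.Idx] : Finite X.NextV := by
  have h : Function.Surjective
      (Sum.elim NextV.master (Sum.elim (fun p => NextV.copy p.1 p.2) (fun p => NextV.new p.1 p.2)) :
        X.V ⊕ (X.Idx × X.V) ⊕ (X.Idx × X.Idx) → X.NextV) := by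
    rintro (u | ⟨S, u⟩ | ⟨S, T⟩)
    · exact ⟨.inl u, rfl⟩
    · exact ⟨.inr (.inl (S, u)), rfl⟩
    · exact ⟨.inr (.inr (S, T)), rfl⟩
  exact Finite.of_surjective _ h

theorem finite_burling (n : ℕ) : Finite (burling n).V ∧ Finite (burling n).Idx := by
  induction n with
  | zero => exact ⟨inferInstanceAs (Finite Unit), inferInstanceAs (Finite Unit)⟩
  | succ n ih =>
    obtain ⟨h₁, h₂⟩ := ih
    exact ⟨finite_nextV _,
      inferInstanceAs (Finite (((burling n).Idx × (burling n).Idx) ⊕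
        ((burling n).Idx × (burling n).Idx)))⟩

/-- The chosen sets are stable: this is why the new vertices create no triangle. -/
theorem not_adj_of_mem_set (n : ℕ) (S : (burling n).Idx) (u w : (burling n).V)
    (hu : u ∈ (burling n).set S) (hw : w ∈ (burling n).set S) : ¬ (burling n).graph.Adj u w := by
  induction n with
  | zero => exact fun h => h
  | succ n ih =>
    intro h
    rcases S with ⟨S, T⟩ | ⟨S, T⟩
    · rcases hu with ⟨u', hu', rfl⟩ | ⟨u', hu', rfl⟩ <;>
        rcases hw with ⟨w', hw', rfl⟩ | ⟨w', hw', rfl⟩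
      · rcases h with h | _
        exact ih S _ _ hu' hw' h
      · rcases h
      · rcases h
      · rcases h with _ | ⟨_, h⟩
        exact ih T _ _ hu' hw' h
    · rcases hu with ⟨u', hu', rfl⟩ | rfl <;> rcases hw with ⟨w', hw', rfl⟩ | rfl
      · rcases h with h | _
        exact ih S _ _ hu' hw' h
      all_goals rcases h

theorem not_triangle_burling (n : ℕ) (a b c : (burling n).V) (hab : (burling n).graph.Adj a b)
    (hac : (burling n).graph.Adj a c) (hbc : (burling n).graph.Adj b c) : False := by
  induction n with
  | zero => exact hab
  | succ n ih =>
    rcases hab with h | ⟨S, h⟩ | ⟨S, T, h⟩ | ⟨S, T, h⟩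
    · rcases hac with h' | _ | _ | _
      rcases hbc with h'' | _ | _ | _
      exact ih _ _ _ h h' h''
    · rcases hac with _ | ⟨_, h'⟩ | ⟨_, T, h'⟩ | _
      · rcases hbc with _ | ⟨_, h''⟩ | _ | _
        exact ih _ _ _ h h' h''
      · rcases hbc with _ | _ | ⟨_, _, h''⟩ | _
        exact not_adj_of_mem_set n T _ _ h' h'' h
    · rcases hac with _ | ⟨_, h'⟩ | ⟨_, T', h'⟩ | _
      · rcases hbc with _ | _ | _ | ⟨_, _, h''⟩
        exact not_adj_of_mem_set n T _ _ h h'' h'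
      · rcases hbc
    · rcases hac with _ | _ | _ | ⟨_, _, h'⟩
      rcases hbc with _ | ⟨_, h''⟩ | _ | _
      exact not_adj_of_mem_set n T _ _ h h' h''

theorem cliqueFree_burling (n : ℕ) : (burling n).graph.CliqueFree 3 := by
  classical
  intro s hs
  obtain ⟨a, b, c, hab, hac, hbc, -⟩ := SimpleGraph.is3Clique_iff.1 hs
  exact not_triangle_burling n a b c hab hac hbc

theorem nonempty_set (n : ℕ) (S : (burling n).Idx) : ((burling n).set S).Nonempty := by
  induction n with
  | zero => exact ⟨(), trivial⟩
  | succ n ih =>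
    rcases S with ⟨S, T⟩ | ⟨S, T⟩
    all_goals
      obtain ⟨u, hu⟩ := ih S
      exact ⟨.master u, .inl ⟨u, hu, rfl⟩⟩

theorem nonempty_idx (n : ℕ) : Nonempty (burling n).Idx := by
  induction n with
  | zero => exact ⟨()⟩
  | succ n ih =>
    obtain ⟨S⟩ := ih
    exact ⟨.inl (S, S)⟩

theorem exists_adj_burling {n : ℕ} (hn : 0 < n) : ∃ u w, (burling n).graph.Adj u w := by
  obtain ⟨n, rfl⟩ := Nat.exists_eq_succ_of_ne_zero hn.ne'
  obtain ⟨S⟩ := nonempty_idx n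
  obtain ⟨u, hu⟩ := nonempty_set n S
  exact ⟨.copy S u, .new S S, .copy_new S S hu⟩

/-- In every proper colouring of the Burling graph, some chosen set receives many colours. -/
theorem exists_set_many_colors (n : ℕ) {κ : Type} (c : (burling n).graph.Coloring κ) :
    ∃ S, ((n + 1 : ℕ) : ℕ∞) ≤ (c '' (burling n).set S).encard := by
  induction n with
  | zero =>
    refine ⟨(), ?_⟩
    rw [zero_add, Nat.cast_one, Set.one_le_encard_iff_nonempty]
    exact (nonempty_set 0 ()).image _
  | succ n ih =>
    obtain ⟨S, hS⟩ := ih (SimpleGraph.Coloring.mk (fun u => c (.master u))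
      (fun h => c.valid (NextAdj.master h)))
    obtain ⟨T, hT⟩ := ih (SimpleGraph.Coloring.mk (fun u => c (.copy S u))
      (fun h => c.valid (NextAdj.copy S h)))
    set A := (fun u => c (.master u)) '' (burling n).set S with hA
    set A' := (fun u => c (.copy S u)) '' (burling n).set T with hA'
    change _ ≤ A.encard at hS
    change _ ≤ A'.encard at hT
    by_cases hlarge : ((n + 1 + 1 : ℕ) : ℕ∞) ≤ (A ∪ A').encard
    · refine ⟨.inl (S, T), hlarge.trans (Set.encard_le_encard ?_)⟩
      rintro _ (⟨u, hu, rfl⟩ | ⟨u, hu, rfl⟩)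
      · exact ⟨_, .inl ⟨u, hu, rfl⟩, rfl⟩
      · exact ⟨_, .inr ⟨u, hu, rfl⟩, rfl⟩
    -- otherwise both sets receive the same colours, and the new vertex has none of them
    have hsmall : (A ∪ A').encard ≤ ((n + 1 : ℕ) : ℕ∞) := by
      rw [not_le, Nat.cast_add_one] at hlarge
      exact ENat.lt_add_one_iff (ENat.natCast_ne_top _) |>.1 hlarge
    have hfin : (A ∪ A').Finite := Set.finite_of_encard_le_coe hsmall
    have h₁ : A = A ∪ A' := hfin.eq_of_subset_of_encard_le' Set.subset_union_left (hsmall.trans hS)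
    have h₂ : A' = A ∪ A' :=
      hfin.eq_of_subset_of_encard_le' Set.subset_union_right (hsmall.trans hT)
    have hnew : c (.new S T) ∉ A := by
      rw [h₁, ← h₂]
      rintro ⟨u, hu, huc⟩
      exact c.valid (NextAdj.copy_new S T hu) huc
    refine ⟨.inr (S, T), ?_⟩
    have hsub : insert (c (.new S T)) A ⊆ c '' (burling (n + 1)).set (.inr (S, T)) := by
      rintro _ (rfl | ⟨u, hu, rfl⟩)
      · exact ⟨_, .inr rfl, rfl⟩
      · exact ⟨_, .inl ⟨u, hu, rfl⟩, rfl⟩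
    refine le_trans ?_ (Set.encard_le_encard hsub)
    rw [Set.encard_insert_of_notMem hnew, Nat.cast_add_one]
    gcongr

theorem lt_card_of_coloring {n : ℕ} {κ : Type} (c : (burling n).graph.Coloring κ) :
    (n : ℕ∞) < ENat.card κ := by
  obtain ⟨S, hS⟩ := exists_set_many_colors n c
  calc (n : ℕ∞) < ((n + 1 : ℕ) : ℕ∞) := by exact_mod_cast n.lt_succ_self
    _ ≤ (c '' (burling n).set S).encard := hS
    _ ≤ (Set.univ : Set κ).encard := Set.encard_le_encard (Set.subset_univ _)
    _ = ENat.card κ := Set.encard_univ κ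

theorem lt_chromaticNumber_burling (n : ℕ) : (n : ℕ∞) < (burling n).graph.chromaticNumber := by
  by_contra! h
  obtain ⟨c⟩ := SimpleGraph.chromaticNumber_le_iff_colorable.1 h
  simpa using lt_card_of_coloring c

end GraphWithSets

/-! ### Representation of the Burling graphs by boxes -/

namespace BoxIntegral.Box

/-- The closed boxes `I` and `J` have a common point. -/
def Meet (I J : Box (Fin 3)) : Prop :=
  ∀ k, I.lower k ≤ J.upper k ∧ J.lower k ≤ I.upper k

theorem Meet.symm {I J : Box (Fin 3)} (h : I.Meet J) : J.Meet I := fun k => (h k).symm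

theorem meet_comm {I J : Box (Fin 3)} : I.Meet J ↔ J.Meet I := ⟨Meet.symm, Meet.symm⟩

/-- Two closed boxes meet exactly when the smallest corner of their would-be intersection lies in
both. -/
theorem nonempty_inter_iff_meet {I J : Box (Fin 3)} :
    (Set.Icc I.lower I.upper ∩ Set.Icc J.lower J.upper).Nonempty ↔ I.Meet J := by
  constructor
  · rintro ⟨p, ⟨h₁, h₂⟩, h₃, h₄⟩ k
    exact ⟨(h₁ k).trans (h₄ k), (h₃ k).trans (h₂ k)⟩
  · intro h
    exact ⟨I.lower ⊔ J.lower,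
      ⟨le_sup_left, sup_le I.lower_le_upper fun k => (h k).2⟩,
      ⟨le_sup_right, sup_le (fun k => (h k).1) J.lower_le_upper⟩⟩

/-- The box `J` lies in the interior of the box `I`. -/
def Inside (J I : Box (Fin 3)) : Prop :=
  ∀ k, I.lower k < J.lower k ∧ J.upper k < I.upper k

/-- The half of `I` which is upper in the third coordinate. -/
noncomputable def upperHalf (I : Box (Fin 3)) : Box (Fin 3) where
  lower := ![I.lower 0, I.lower 1, (I.lower 2 + I.upper 2) / 2]
  upper := ![I.upper 0, I.upper 1, I.upper 2]
  lower_lt_upper k := by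
    have := I.lower_lt_upper
    fin_cases k
    · exact this 0
    · exact this 1
    · simpa using by linarith [this 2]

theorem sides (I : Box (Fin 3)) :
    I.lower 0 < I.upper 0 ∧ I.lower 1 < I.upper 1 ∧ I.lower 2 < I.upper 2 :=
  ⟨I.lower_lt_upper 0, I.lower_lt_upper 1, I.lower_lt_upper 2⟩

theorem meet_iff {I J : Box (Fin 3)} : I.Meet J ↔
    (I.lower 0 ≤ J.upper 0 ∧ J.lower 0 ≤ I.upper 0) ∧
    (I.lower 1 ≤ J.upper 1 ∧ J.lower 1 ≤ I.upper 1) ∧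
    I.lower 2 ≤ J.upper 2 ∧ J.lower 2 ≤ I.upper 2 := by
  simp only [Meet, Fin.forall_fin_succ, IsEmpty.forall_iff, and_true]
  rfl

theorem inside_iff {I J : Box (Fin 3)} : J.Inside I ↔
    (I.lower 0 < J.lower 0 ∧ J.upper 0 < I.upper 0) ∧
    (I.lower 1 < J.lower 1 ∧ J.upper 1 < I.upper 1) ∧
    I.lower 2 < J.lower 2 ∧ J.upper 2 < I.upper 2 := by
  simp only [Inside, Fin.forall_fin_succ, IsEmpty.forall_iff, and_true]
  rfl

theorem Inside.upperHalf {I J : Box (Fin 3)} (h : J.Inside I.upperHalf) :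
    (I.lower 0 < J.lower 0 ∧ J.upper 0 < I.upper 0) ∧
    (I.lower 1 < J.lower 1 ∧ J.upper 1 < I.upper 1) ∧
    (I.lower 2 + I.upper 2) / 2 < J.lower 2 ∧ J.upper 2 < I.upper 2 :=
  inside_iff.1 h

/-- The projection of `J` to the first two coordinates lies in that of `I`, and `J` stays below the
top of `I`. If `I` is a root in a representation of a graph by boxes, then such a `J` is contained
in the union of `I` and of the part of the probe under it, where there is no box. -/
def InProbe (J I : Box (Fin 3)) : Prop :=
  I.lower 0 ≤ J.lower 0 ∧ J.upper 0 ≤ I.upper 0 ∧ I.lower 1 ≤ J.lower 1 ∧ J.upper 1 ≤ I.upper 1 ∧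
    J.upper 2 ≤ I.upper 2

theorem Inside.inProbe {J I : Box (Fin 3)} (h : J.Inside I.upperHalf) : J.InProbe I :=
  ⟨(h 0).1.le, (h 0).2.le, (h 1).1.le, (h 1).2.le, (h 2).2.le⟩

section Step

variable {I J : Box (Fin 3)} (h : J.Inside I.upperHalf)

/-- The box of the new vertex: in the second coordinate it occupies the first half of the root `J`,
and in the third it sticks out of the upper half of `I` down to the bottom of `I`. -/
noncomputable def newBox : Box (Fin 3) where
  lower := ![J.lower 0, J.lower 1, I.lower 2]
  upper := ![I.upper 0, (J.lower 1 + J.upper 1) / 2, J.upper 2]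
  lower_lt_upper k := by
    have h₁ := J.lower_lt_upper
    have h₂ := I.lower_lt_upper
    fin_cases k
    · exact (h₁ 0).trans (h 0).2
    · simpa using by linarith [h₁ 1]
    · have := (h 2).1
      simp only [upperHalf, Matrix.cons_val] at this
      simpa using by linarith [h₁ 2, h₂ 2]

/-- The root of the union of the two old sets: in the second coordinate it is the last quarter of
`J`, so that its probe avoids the box of the new vertex. -/
noncomputable def unionRoot (J : Box (Fin 3)) : Box (Fin 3) where
  lower := ![J.lower 0, (J.lower 1 + 3 * J.upper 1) / 4, J.lower 2]
  upper := ![J.upper 0, J.upper 1, J.upper 2]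
  lower_lt_upper k := by
    have h₁ := J.lower_lt_upper
    fin_cases k
    · exact h₁ 0
    · simpa using by linarith [h₁ 1]
    · exact h₁ 2

/-- The root of the set containing the new vertex: it lies before the box of the new vertex in the
first coordinate, and below the upper half of `I` in the third one, so that its probe crosses the
box of the new vertex and passes under the copy that lives in this half. -/
noncomputable def newRoot : Box (Fin 3) where
  lower := ![I.lower 0, J.lower 1, (3 * I.lower 2 + I.upper 2) / 4]
  upper := ![(I.lower 0 + J.lower 0) / 2, (J.lower 1 + J.upper 1) / 2,
    (I.lower 2 + I.upper 2) / 2]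
  lower_lt_upper k := by
    have h₁ := J.lower_lt_upper
    have h₂ := I.lower_lt_upper
    fin_cases k
    · have := (h 0).1
      simp only [upperHalf, Matrix.cons_val] at this
      simpa using by linarith
    · simpa using by linarith [h₁ 1]
    · simpa using by linarith [h₂ 2]

theorem newBox_inProbe : (newBox h).InProbe I := by
  have h₁ := J.lower_lt_upper 1
  obtain ⟨h₂, h₃, h₄, h₅, h₆⟩ := h.inProbe
  refine ⟨h₂, le_rfl, h₄, ?_, h₆⟩
  simpa [newBox] using by linarith

end Step

end BoxIntegral.Box

open BoxIntegral

/-- A representation, inside the box `D`, of the graph `X` as the intersection graph of a family of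
boxes, with a root box for each of the chosen sets. The probe of a root is the set of the points
which in the first coordinate are after the beginning of the root, in the second one are in the
range of the root, and in the third one are below the top of the root. The probe of the root of
a set meets the boxes of the elements of this set, which cross it behind the root, and no other box;
and the probes of distinct sets are disjoint. -/
structure BoxRepresentation (X : GraphWithSets) (D : Box (Fin 3)) where
  box : X.V → Box (Fin 3)
  root : X.Idx → Box (Fin 3)
  box_inside : ∀ v, (box v).Inside D
  root_inside : ∀ S, (root S).Inside D
  root_disjoint : ∀ S T, S ≠ T →
    (root S).upper 1 < (root T).lower 1 ∨ (root T).upper 1 < (root S).lower 1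
  cross : ∀ S v, v ∈ X.set S → (root S).upper 0 < (box v).lower 0 ∧
    (box v).lower 1 ≤ (root S).lower 1 ∧ (root S).upper 1 ≤ (box v).upper 1 ∧
    (box v).lower 2 < (root S).lower 2
  avoid : ∀ S v, v ∉ X.set S → (box v).upper 0 < (root S).lower 0 ∨
    (box v).upper 1 < (root S).lower 1 ∨ (root S).upper 1 < (box v).lower 1 ∨
    (root S).upper 2 < (box v).lower 2
  adj_iff : ∀ u w, u ≠ w → (X.graph.Adj u w ↔ (box u).Meet (box w))

namespace BoxRepresentation

open BoxIntegral.Box GraphWithSets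

variable {X : GraphWithSets} {D : Box (Fin 3)}

/-- No box of the representation enters the root of a set, nor the part of the probe under it. -/
theorem not_meet_of_inProbe (R : BoxRepresentation X D) {S : X.Idx} {K : Box (Fin 3)}
    (hK : K.InProbe (R.root S)) (v : X.V) : ¬ (R.box v).Meet K := by
  intro hm
  obtain ⟨h₁, h₂, h₃, h₄, h₅⟩ := hK
  have m₀ := hm 0
  have m₁ := hm 1
  have m₂ := hm 2
  by_cases hv : v ∈ X.set S
  · linarith [(R.cross S v hv).1]
  · rcases R.avoid S v hv with h | h | h | h <;> linarith

theorem not_meet_of_ne (R : BoxRepresentation X D) {S S' : X.Idx} (hne : S ≠ S')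
    {K K' : Box (Fin 3)} (hK : K.InProbe (R.root S)) (hK' : K'.InProbe (R.root S')) :
    ¬ K.Meet K' := by
  intro hm
  obtain ⟨-, -, h₃, h₄, -⟩ := hK
  obtain ⟨-, -, h₃', h₄', -⟩ := hK'
  have m₁ := hm 1
  rcases R.root_disjoint S S' hne with h | h <;> linarith

section Step

variable (R : BoxRepresentation X D) (H : ∀ S, BoxRepresentation X (R.root S).upperHalf)

/-- The boxes of the next Burling graph: a representation of the copy of index `S` is put in the
upper half of the root of `S`. -/
noncomputable def nextBox : X.NextV → Box (Fin 3)
  | .master u => R.box u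
  | .copy S u => (H S).box u
  | .new S T => newBox ((H S).root_inside T)

/-- The roots of the next Burling graph. -/
noncomputable def nextRoot : (X.Idx × X.Idx) ⊕ (X.Idx × X.Idx) → Box (Fin 3)
  | .inl p => unionRoot ((H p.1).root p.2)
  | .inr p => newRoot ((H p.1).root_inside p.2)

theorem inProbe_nextBox_copy (S : X.Idx) (u : X.V) : ((H S).box u).InProbe (R.root S) :=
  ((H S).box_inside u).inProbe

theorem inProbe_nextBox_new (S T : X.Idx) :
    (newBox ((H S).root_inside T)).InProbe (R.root S) :=
  newBox_inProbe _

theorem nextBox_inside (v : X.NextV) : (R.nextBox H v).Inside D := by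
  rcases v with u | ⟨S, u⟩ | ⟨S, T⟩
  · exact R.box_inside u
  · have h₁ := inside_iff.1 (R.root_inside S)
    have h₂ := ((H S).box_inside u).upperHalf
    have h₃ := (R.root S).sides
    rw [inside_iff]
    simp only [nextBox]
    grind
  · have h₁ := inside_iff.1 (R.root_inside S)
    have h₂ := ((H S).root_inside T).upperHalf
    have h₃ := (R.root S).sides
    have h₄ := ((H S).root T).sides
    rw [inside_iff]
    simp only [nextBox, newBox, Matrix.cons_val]
    grind

theorem nextRoot_inside (p) : (nextRoot R H p).Inside D := by
  rcases p with ⟨S, T⟩ | ⟨S, T⟩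
  all_goals
    have h₁ := inside_iff.1 (R.root_inside S)
    have h₂ := ((H S).root_inside T).upperHalf
    have h₃ := (R.root S).sides
    have h₄ := ((H S).root T).sides
    rw [inside_iff]
    simp only [nextRoot, newRoot, unionRoot, Matrix.cons_val]
    grind

/-- The second sides of the new roots lie in those of the old ones; the two roots obtained from one
pair of sets use disjoint parts of it. -/
theorem nextRoot_disjoint (p q) (hne : p ≠ q) :
    (nextRoot R H p).upper 1 < (nextRoot R H q).lower 1 ∨
      (nextRoot R H q).upper 1 < (nextRoot R H p).lower 1 := by
  have key : ∀ S T S' T', (S ≠ S' ∨ T ≠ T') →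
      ((H S).root T).upper 1 < ((H S').root T').lower 1 ∨
        ((H S').root T').upper 1 < ((H S).root T).lower 1 := by
    intro S T S' T' h
    by_cases hS : S = S'
    · subst hS
      exact (H S).root_disjoint T T' (h.resolve_left fun h => h rfl)
    · have h₁ := (H S).root_inside T 1
      have h₂ := (H S').root_inside T' 1
      have h₃ := R.root_disjoint S S' hS
      have h₄ := ((H S).root T).lower_lt_upper 1
      have h₅ := ((H S').root T').lower_lt_upper 1
      simp only [upperHalf, Matrix.cons_val] at h₁ h₂
      rcases h₃ with h₃ | h₃
      · left; linarith
      · right; linarith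
  rcases p with ⟨S, T⟩ | ⟨S, T⟩ <;> rcases q with ⟨S', T'⟩ | ⟨S', T'⟩
  all_goals
    have h₁ := ((H S).root T).lower_lt_upper 1
    have h₂ := ((H S').root T').lower_lt_upper 1
    by_cases h : S ≠ S' ∨ T ≠ T'
    · have h₃ := key S T S' T' h
      simp only [nextRoot, newRoot, unionRoot, Matrix.cons_val]
      grind
    · push Not at h
      obtain ⟨rfl, rfl⟩ := h
      first
      | exact absurd rfl hne
      | simp only [nextRoot, newRoot, unionRoot, Matrix.cons_val]
        grind

/-- The probes of both new roots start in the root of `S`, and so cross the boxes of `S`; the first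
is part of the probe of `T` in the copy, and the second runs into the box of the new vertex. -/
theorem nextRoot_cross (p : (X.Idx × X.Idx) ⊕ (X.Idx × X.Idx)) (v : X.NextV)
    (hv : v ∈ X.next.set p) :
    (nextRoot R H p).upper 0 < (R.nextBox H v).lower 0 ∧
    (R.nextBox H v).lower 1 ≤ (nextRoot R H p).lower 1 ∧
    (nextRoot R H p).upper 1 ≤ (R.nextBox H v).upper 1 ∧
    (R.nextBox H v).lower 2 < (nextRoot R H p).lower 2 := by
  rcases p with ⟨S, T⟩ | ⟨S, T⟩
  all_goals
    have a₁ := (R.root S).sides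
    have a₂ := ((H S).root T).sides
    have a₃ := ((H S).root_inside T).upperHalf
  · rcases hv with ⟨u, hu, rfl⟩ | ⟨u, hu, rfl⟩
    · have := R.cross S u hu
      simp only [nextBox, nextRoot, unionRoot, Matrix.cons_val]
      grind
    · have := (H S).cross T u hu
      simp only [nextBox, nextRoot, unionRoot, Matrix.cons_val]
      grind
  · rcases hv with ⟨u, hu, rfl⟩ | rfl
    · have := R.cross S u hu
      simp only [nextBox, nextRoot, newRoot, Matrix.cons_val]
      grind
    · simp only [nextBox, nextRoot, newRoot, newBox, Matrix.cons_val]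
      grind

/-- The probes of both new roots are contained in the probe of the old root, whence `hroot`; so they
meet no other box of the master copy, and nothing that lives in the other roots. -/
theorem nextRoot_avoid (p : (X.Idx × X.Idx) ⊕ (X.Idx × X.Idx)) (v : X.NextV)
    (hv : v ∉ X.next.set p) :
    (R.nextBox H v).upper 0 < (nextRoot R H p).lower 0 ∨
    (R.nextBox H v).upper 1 < (nextRoot R H p).lower 1 ∨
    (nextRoot R H p).upper 1 < (R.nextBox H v).lower 1 ∨
    (nextRoot R H p).upper 2 < (R.nextBox H v).lower 2 := by
  have hroot : ∀ S T, p = .inl (S, T) ∨ p = .inr (S, T) →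
      (R.root S).lower 0 ≤ (nextRoot R H p).lower 0 ∧
      (R.root S).lower 1 ≤ (nextRoot R H p).lower 1 ∧
      (nextRoot R H p).upper 1 ≤ (R.root S).upper 1 ∧
      (nextRoot R H p).upper 2 ≤ (R.root S).upper 2 := by
    intro S T h
    have a₁ := (R.root S).sides
    have a₂ := ((H S).root T).sides
    have a₃ := ((H S).root_inside T).upperHalf
    rcases h with rfl | rfl
    all_goals
      simp only [nextRoot, unionRoot, newRoot, Matrix.cons_val]
      grind
  have hfar : ∀ S T S', p = .inl (S, T) ∨ p = .inr (S, T) → S ≠ S' →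
      (R.nextBox H v).InProbe (R.root S') →
      (R.nextBox H v).upper 1 < (nextRoot R H p).lower 1 ∨
      (nextRoot R H p).upper 1 < (R.nextBox H v).lower 1 := by
    intro S T S' h hne hv
    obtain ⟨-, -, h₁, h₂, -⟩ := hv
    have h₃ := R.root_disjoint S S' hne
    have h₄ := hroot S T h
    grind
  have hmaster : ∀ S T u, p = .inl (S, T) ∨ p = .inr (S, T) → v = .master u →
      (R.nextBox H v).upper 0 < (nextRoot R H p).lower 0 ∨
      (R.nextBox H v).upper 1 < (nextRoot R H p).lower 1 ∨
      (nextRoot R H p).upper 1 < (R.nextBox H v).lower 1 ∨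
      (nextRoot R H p).upper 2 < (R.nextBox H v).lower 2 := by
    rintro S T u h rfl
    have h₁ := R.avoid S u (by
      rintro hu
      rcases h with rfl | rfl
      · exact hv (.inl ⟨u, hu, rfl⟩)
      · exact hv (.inl ⟨u, hu, rfl⟩))
    have h₂ := hroot S T h
    simp only [nextBox]
    grind
  rcases p with ⟨S, T⟩ | ⟨S, T⟩
  · rcases v with u | ⟨S', u⟩ | ⟨S', T'⟩
    · exact hmaster S T u (.inl rfl) rfl
    · by_cases hS : S = S'
      · subst hS
        have h₁ := (H S).avoid T u fun hu => hv (.inr ⟨u, hu, rfl⟩)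
        have h₂ := ((H S).root T).lower_lt_upper 1
        simp only [nextBox, nextRoot, unionRoot, Matrix.cons_val]
        grind
      · exact .inr ((hfar S T S' (.inl rfl) hS (R.inProbe_nextBox_copy H S' u)).imp_right .inl)
    · by_cases hS : S = S'
      · subst hS
        have h₁ := ((H S).root T).lower_lt_upper 1
        have h₂ := ((H S).root T').lower_lt_upper 1
        simp only [nextBox, nextRoot, unionRoot, newBox, Matrix.cons_val]
        rcases eq_or_ne T T' with rfl | hT
        · right; left; linarith
        · rcases (H S).root_disjoint T T' hT with h₃ | h₃
          · right; right; left; linarith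
          · right; left; linarith
      · exact .inr ((hfar S T S' (.inl rfl) hS (R.inProbe_nextBox_new H S' T')).imp_right .inl)
  · rcases v with u | ⟨S', u⟩ | ⟨S', T'⟩
    · exact hmaster S T u (.inr rfl) rfl
    · by_cases hS : S = S'
      · subst hS
        have h₁ := (H S).box_inside u 2
        simp only [nextBox, nextRoot, newRoot, upperHalf, Matrix.cons_val] at h₁ ⊢
        grind
      · exact .inr ((hfar S T S' (.inr rfl) hS (R.inProbe_nextBox_copy H S' u)).imp_right .inl)
    · by_cases hS : S = S'
      · subst hS
        have hT : T ≠ T' := by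
          rintro rfl
          exact hv (.inr rfl)
        have h₁ := ((H S).root T).lower_lt_upper 1
        have h₂ := ((H S).root T').lower_lt_upper 1
        have h₃ := (H S).root_disjoint T T' hT
        simp only [nextBox, nextRoot, newRoot, newBox, Matrix.cons_val]
        grind
      · exact .inr ((hfar S T S' (.inr rfl) hS (R.inProbe_nextBox_new H S' T')).imp_right .inl)

/-- The box of a new vertex meets exactly the boxes of the vertices it is joined to. -/
theorem meet_newBox_iff (S T : X.Idx) (u : X.V) :
    ((H S).box u).Meet (newBox ((H S).root_inside T)) ↔ u ∈ X.set T := by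
  have a₁ := ((H S).root T).sides
  have a₂ := ((H S).box u).sides
  have a₃ := ((H S).root_inside T).upperHalf
  have a₄ := ((H S).box_inside u).upperHalf
  have a₅ := (R.root S).sides
  rw [meet_iff]
  simp only [newBox, Matrix.cons_val]
  by_cases hu : u ∈ X.set T
  · have h := (H S).cross T u hu
    refine iff_of_true ?_ hu
    grind
  · have h := (H S).avoid T u hu
    refine iff_of_false ?_ hu
    intro hm
    grind

theorem nextBox_adj_iff (u w : X.NextV) (hne : u ≠ w) :
    X.NextAdj u w ↔ (R.nextBox H u).Meet (R.nextBox H w) := by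
  have hcopy := R.inProbe_nextBox_copy H
  have hnew := R.inProbe_nextBox_new H
  rcases u with u | ⟨S, u⟩ | ⟨S, T⟩ <;> rcases w with w | ⟨S', w⟩ | ⟨S', T'⟩
  · refine Iff.trans ⟨?_, .master⟩ (R.adj_iff u w fun h => hne (congrArg _ h))
    rintro (h | _)
    exact h
  · exact iff_of_false (by rintro ⟨⟩) (R.not_meet_of_inProbe (hcopy S' w) u)
  · exact iff_of_false (by rintro ⟨⟩) (R.not_meet_of_inProbe (hnew S' T') u)
  · exact iff_of_false (by rintro ⟨⟩) fun h => R.not_meet_of_inProbe (hcopy S u) w h.symm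
  · by_cases hS : S = S'
    · subst hS
      refine Iff.trans ⟨?_, .copy S⟩ ((H S).adj_iff u w fun h => hne (congrArg _ h))
      rintro (_ | ⟨_, h⟩)
      exact h
    · refine iff_of_false ?_ (R.not_meet_of_ne hS (hcopy S u) (hcopy S' w))
      rintro (_ | ⟨_, h⟩)
      exact hS rfl
  · by_cases hS : S = S'
    · subst hS
      refine Iff.trans ⟨?_, .copy_new S T'⟩ (R.meet_newBox_iff H S T' u).symm
      rintro (_ | _ | ⟨_, _, h⟩)
      exact h
    · refine iff_of_false ?_ (R.not_meet_of_ne hS (hcopy S u) (hnew S' T'))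
      rintro (_ | _ | ⟨_, _, h⟩)
      exact hS rfl
  · exact iff_of_false (by rintro ⟨⟩) fun h => R.not_meet_of_inProbe (hnew S T) w h.symm
  · by_cases hS : S = S'
    · subst hS
      refine Iff.trans ⟨?_, .new_copy S T⟩ ((R.meet_newBox_iff H S T w).symm.trans meet_comm)
      rintro (_ | _ | _ | ⟨_, _, h⟩)
      exact h
    · refine iff_of_false ?_ (R.not_meet_of_ne hS (hnew S T) (hcopy S' w))
      rintro (_ | _ | _ | ⟨_, _, h⟩)
      exact hS rfl
  · refine iff_of_false (by rintro ⟨⟩) ?_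
    by_cases hS : S = S'
    · subst hS
      have hT : T ≠ T' := fun h => hne (congrArg _ h)
      intro hm
      have h₁ := hm 1
      have h₂ := ((H S).root T).lower_lt_upper 1
      have h₃ := ((H S).root T').lower_lt_upper 1
      have h₄ := (H S).root_disjoint T T' hT
      simp only [nextBox, newBox, Matrix.cons_val] at h₁
      grind
    · exact R.not_meet_of_ne hS (hnew S T) (hnew S' T')

/-- The step of Burling's construction, for representations by boxes. -/
noncomputable def next : BoxRepresentation X.next D where
  box := R.nextBox H
  root := nextRoot R H
  box_inside := R.nextBox_inside H
  root_inside := nextRoot_inside R H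
  root_disjoint := nextRoot_disjoint R H
  cross := nextRoot_cross R H
  avoid := nextRoot_avoid R H
  adj_iff := R.nextBox_adj_iff H

end Step

/-- The box with corners at the fractions `s k / 6` and `t k / 6` of the sides of `D`. -/
noncomputable def subBox (D : Box (Fin 3)) (s t : Fin 3 → ℝ) (h : ∀ k, s k < t k) :
    Box (Fin 3) where
  lower k := D.lower k + s k / 6 * (D.upper k - D.lower k)
  upper k := D.lower k + t k / 6 * (D.upper k - D.lower k)
  lower_lt_upper k := by
    have := sub_pos.2 (D.lower_lt_upper k)
    have := h k
    gcongr

theorem nonempty_burling (n : ℕ) (D : Box (Fin 3)) :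
    Nonempty (BoxRepresentation (burling n) D) := by
  induction n generalizing D with
  | zero =>
    have h₀ := D.lower_lt_upper 0
    have h₁ := D.lower_lt_upper 1
    have h₂ := D.lower_lt_upper 2
    refine ⟨{
      box := fun _ => subBox D ![3, 1, 1] ![5, 5, 5] (by simp [Fin.forall_fin_succ]; norm_num)
      root := fun _ => subBox D ![1, 2, 2] ![2, 4, 4] (by simp [Fin.forall_fin_succ]; norm_num)
      box_inside := fun _ => by
        rw [inside_iff]
        simp only [subBox, Matrix.cons_val]
        grind
      root_inside := fun _ => by
        rw [inside_iff]
        simp only [subBox, Matrix.cons_val]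
        grind
      root_disjoint := fun S T h => absurd rfl h
      cross := fun _ _ _ => by
        simp [subBox]
        grind
      avoid := fun _ _ h => absurd trivial h
      adj_iff := fun _ _ h => absurd rfl h }⟩
  | succ n ih =>
    obtain ⟨R⟩ := ih D
    exact ⟨R.next fun S => (ih (R.root S).upperHalf).some⟩

end BoxRepresentation

/-! ### Symmetric differences with singletons -/

namespace Set

variable {E : Type*} {C : Set E} {e : E}

theorem symmDiff_singleton_of_notMem (he : e ∉ C) : symmDiff C {e} = insert e C := by
  ext x
  simp only [mem_symmDiff, mem_singleton_iff, mem_insert_iff]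
  grind

theorem symmDiff_singleton_of_mem (he : e ∈ C) : symmDiff C {e} = C \ {e} := by
  ext x
  simp only [mem_symmDiff, mem_singleton_iff, mem_sdiff]
  grind

theorem symmDiff_insert_self (he : e ∉ C) : symmDiff C (insert e C) = {e} := by
  rw [← symmDiff_singleton_of_notMem he, symmDiff_symmDiff_cancel_left]

theorem mem_iff_of_symmDiff_eq_singleton {D : Set E} (h : symmDiff C D = {e}) (x : E) :
    x ∈ D ↔ (x ∈ C ↔ x ≠ e) := by
  have := Set.ext_iff.1 h x
  simp only [mem_symmDiff, mem_singleton_iff] at this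
  grind

end Set

/-! ### Configurations of a finite event structure -/

namespace EventStructure

variable {E : Type*} (𝓔 : EventStructure E)

theorem not_conflict_of_le {e a b : E} (ha : 𝓔.le a e) (hb : 𝓔.le b e) : ¬ 𝓔.conflict a b :=
  fun h => 𝓔.conflict_irrefl e
    (𝓔.conflict_hered _ _ _ (𝓔.conflict_symm _ _ (𝓔.conflict_hered _ _ _ h hb)) ha)

theorem conflict_of_le {a b e f : E} (h : 𝓔.conflict a b) (ha : 𝓔.le a e) (hb : 𝓔.le b f) :
    𝓔.conflict e f :=
  𝓔.conflict_symm _ _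
    (𝓔.conflict_hered _ _ _ (𝓔.conflict_symm _ _ (𝓔.conflict_hered _ _ _ h hb)) ha)

variable {𝓔}

theorem MinimalConflict.symm {e f : E} (h : 𝓔.MinimalConflict e f) : 𝓔.MinimalConflict f e := by
  refine ⟨𝓔.conflict_symm _ _ h.1, ?_⟩
  rintro ⟨g, h₁, h₂, h₃⟩
  exact h.2 ⟨g, h₂, h₁, h₃.symm⟩

theorem Independent.symm {e f : E} (h : 𝓔.Independent e f) : 𝓔.Independent f e :=
  h.imp (fun h => ⟨h.2.1, h.1, fun h' => h.2.2 (𝓔.conflict_symm _ _ h')⟩) MinimalConflict.symm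

theorem Independent.not_le {e f : E} (h : 𝓔.Independent e f) : ¬ 𝓔.le e f :=
  h.elim (fun h => h.1) fun h hle => 𝓔.not_conflict_of_le hle (𝓔.le_refl f) h.1

theorem Independent.ne {e f : E} (h : 𝓔.Independent e f) : e ≠ f := by
  rintro rfl
  exact h.not_le (𝓔.le_refl e)

/-- Events below independent events conflict only if they are these events. -/
theorem Independent.not_conflict_of_le_of_ne {a b e f : E} (h : 𝓔.Independent e f)
    (ha : 𝓔.le a e) (hb : 𝓔.le b f) (hne : b ≠ f) : ¬ 𝓔.conflict a b := by
  intro hab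
  rcases h with h | h
  · exact h.2.2 (𝓔.conflict_of_le hab ha hb)
  · have heb : 𝓔.conflict e b := 𝓔.conflict_of_le hab ha (𝓔.le_refl b)
    refine h.2 ⟨b, ?_, hne, .inr ⟨hb, 𝓔.conflict_symm _ _ heb⟩⟩
    rintro rfl
    exact 𝓔.conflict_irrefl _ heb

variable (𝓔) in
/-- The events strictly below `e` or `f`. -/
def below (e f : E) : Set E := {x | (𝓔.le x e ∨ 𝓔.le x f) ∧ x ≠ e ∧ x ≠ f}

theorem below_comm (e f : E) : 𝓔.below e f = 𝓔.below f e := by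
  ext x
  simp only [below, Set.mem_ofPred_eq]
  tauto

/-- The case `e = f` says that `e` can be added to the set of all the events strictly below it. -/
theorem isConfiguration_insert_below {e f : E} (h : e = f ∨ 𝓔.Independent e f) :
    𝓔.IsConfiguration (insert e (𝓔.below e f)) := by
  have key : ∀ a b, 𝓔.le a e → 𝓔.le b f → b ≠ f → ¬ 𝓔.conflict a b := by
    intro a b ha hb hbf
    rcases h with rfl | h
    · exact 𝓔.not_conflict_of_le ha hb
    · exact h.not_conflict_of_le_of_ne ha hb hbf
  have hmem : ∀ x ∈ insert e (𝓔.below e f), 𝓔.le x e ∨ 𝓔.le x f ∧ x ≠ f := by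
    rintro x (rfl | hx)
    · exact .inl (𝓔.le_refl x)
    · exact hx.1.imp_right fun h => ⟨h, hx.2.2⟩
  constructor
  · intro a ha b hb hab
    rcases hmem a ha with ha | ha <;> rcases hmem b hb with hb | hb
    · exact 𝓔.not_conflict_of_le ha hb hab
    · exact key a b ha hb.1 hb.2 hab
    · exact key b a hb ha.1 ha.2 (𝓔.conflict_symm _ _ hab)
    · exact 𝓔.not_conflict_of_le ha.1 hb.1 hab
  · intro x hx y hy
    by_cases hye : y = e
    · exact .inl hye
    right
    have hyf : y ≠ f := by
      rintro rfl
      rcases hmem x hx with hx | hx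
      · rcases h with h | h
        · exact hye h.symm
        · exact h.symm.not_le (𝓔.le_trans _ _ _ hy hx)
      · exact hx.2 (𝓔.le_antisymm _ _ hx.1 hy)
    refine ⟨?_, hye, hyf⟩
    exact (hmem x hx).imp (𝓔.le_trans _ _ _ hy) fun h => 𝓔.le_trans _ _ _ hy h.1

theorem isConfiguration_below {e f : E} (h : e = f ∨ 𝓔.Independent e f) :
    𝓔.IsConfiguration (𝓔.below e f) := by
  refine ⟨fun a ha b hb => (isConfiguration_insert_below h).1 a (.inr ha) b (.inr hb), ?_⟩
  intro x hx y hy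
  refine ((isConfiguration_insert_below h).2 x (.inr hx) y hy).resolve_left ?_
  rintro rfl
  rcases hx with ⟨hx | hx, hne, hne'⟩
  · exact hne (𝓔.le_antisymm _ _ hx hy)
  · rcases h with rfl | h
    · exact hne (𝓔.le_antisymm _ _ hx hy)
    · exact h.not_le (𝓔.le_trans _ _ _ hy hx)

theorem notMem_below_left (e f : E) : e ∉ 𝓔.below e f := fun h => h.2.1 rfl

theorem notMem_below_right (e f : E) : f ∉ 𝓔.below e f := fun h => h.2.2 rfl

/-- Two events that can be added to the same configuration are independent. -/
theorem independent_of_insert {C : Set E} {e f : E} (he : e ∉ C) (hf : f ∉ C) (hne : e ≠ f)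
    (hCe : 𝓔.IsConfiguration (insert e C)) (hCf : 𝓔.IsConfiguration (insert f C)) :
    𝓔.Independent e f := by
  have hlt : ∀ g, 𝓔.le g e → g ≠ e → g ∈ C := fun g hg hge =>
    (hCe.2 e (.inl rfl) g hg).resolve_left hge
  have hlt' : ∀ g, 𝓔.le g f → g ≠ f → g ∈ C := fun g hg hge =>
    (hCf.2 f (.inl rfl) g hg).resolve_left hge
  by_cases hc : 𝓔.conflict e f
  · refine .inr ⟨hc, ?_⟩
    rintro ⟨g, hge, hgf, ⟨hg, hgc⟩ | ⟨hg, hgc⟩⟩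
    · exact hCf.1 _ (.inr (hlt g hg hge)) _ (.inl rfl) hgc
    · exact hCe.1 _ (.inr (hlt' g hg hgf)) _ (.inl rfl) hgc
  · exact .inl ⟨fun h => he (hlt' e h hne), fun h => hf (hlt f h hne.symm), hc⟩

/-- A configuration can be moved towards another one by adding or removing one event. -/
theorem exists_isConfiguration_symmDiff [Finite E] {C D : Set E} (hC : 𝓔.IsConfiguration C)
    (hD : 𝓔.IsConfiguration D) (hne : C ≠ D) :
    ∃ e ∈ symmDiff C D, 𝓔.IsConfiguration (symmDiff C {e}) := by
  let _ := 𝓔.toPartialOrder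
  by_cases hsub : C ⊆ D
  · have hne' : (D \ C).Nonempty := by
      rw [Set.sdiff_nonempty]
      exact fun h => hne (hsub.antisymm h)
    obtain ⟨e, he⟩ := (D \ C).toFinite.exists_minimal hne'
    refine ⟨e, .inr he.prop, ?_⟩
    rw [Set.symmDiff_singleton_of_notMem he.prop.2]
    have hins : insert e C ⊆ D := Set.insert_subset he.prop.1 hsub
    refine ⟨fun a ha b hb => hD.1 a (hins ha) b (hins hb), ?_⟩
    rintro x (rfl | hx) y hy
    · by_cases hyC : y ∈ C
      · exact .inr hyC
      · exact .inl (𝓔.le_antisymm _ _ hy (he.le_of_le ⟨hD.2 x he.prop.1 y hy, hyC⟩ hy))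
    · exact .inr (hC.2 x hx y hy)
  · obtain ⟨e, he⟩ := (C \ D).toFinite.exists_maximal (Set.sdiff_nonempty.2 hsub)
    refine ⟨e, .inl he.prop, ?_⟩
    rw [Set.symmDiff_singleton_of_mem he.prop.1]
    refine ⟨fun a ha b hb => hC.1 a ha.1 b hb.1, ?_⟩
    rintro x ⟨hx, hxe⟩ y hy
    refine ⟨hC.2 x hx y hy, ?_⟩
    rintro rfl
    have hxD : x ∉ D := fun h => he.prop.2 (hD.2 x h _ hy)
    exact hxe (𝓔.le_antisymm _ _ (he.le_of_ge ⟨hx, hxD⟩ hy) hy)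

/-- The median of three configurations is their majority set: two of its elements lie in a common
configuration among the three. -/
theorem isConfiguration_majority {A B C : Set E} (hA : 𝓔.IsConfiguration A)
    (hB : 𝓔.IsConfiguration B) (hC : 𝓔.IsConfiguration C) :
    𝓔.IsConfiguration ((A ∩ B) ∪ (B ∩ C) ∪ (C ∩ A)) := by
  constructor
  · intro a ha b hb hab
    have h₁ : ¬ (a ∈ A ∧ b ∈ A) := fun h => hA.1 a h.1 b h.2 hab
    have h₂ : ¬ (a ∈ B ∧ b ∈ B) := fun h => hB.1 a h.1 b h.2 hab
    have h₃ : ¬ (a ∈ C ∧ b ∈ C) := fun h => hC.1 a h.1 b h.2 hab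
    simp only [Set.mem_union, Set.mem_inter_iff] at ha hb
    tauto
  · intro x hx y hy
    have h₁ := fun h => hA.2 x h y hy
    have h₂ := fun h => hB.2 x h y hy
    have h₃ := fun h => hC.2 x h y hy
    simp only [Set.mem_union, Set.mem_inter_iff] at hx ⊢
    tauto

/-- In the domain, a configuration is covered by those obtained from it by adding one event. -/
theorem covBy_iff_insert [Finite E] {C D : 𝓔.Domain} :
    C ⋖ D ↔ ∃ e ∉ C.1, D.1 = insert e C.1 := by
  constructor
  · intro h
    have hsub : C.1 ⊆ D.1 := h.1.le
    obtain ⟨e, he, hconf⟩ := exists_isConfiguration_symmDiff C.2 D.2 fun heq =>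
      h.1.ne (Subtype.ext heq)
    have heC : e ∉ C.1 := by
      rcases he with he | he
      · exact absurd (hsub he.1) he.2
      · exact he.2
    have heD : e ∈ D.1 := by
      rcases he with he | he
      · exact hsub he.1
      · exact he.1
    rw [Set.symmDiff_singleton_of_notMem heC] at hconf
    refine ⟨e, heC, ?_⟩
    have hlt : C < (⟨_, hconf⟩ : 𝓔.Domain) :=
      lt_of_le_of_ne (Set.subset_insert e C.1) fun h =>
        heC (by rw [congrArg Subtype.val h]; exact Set.mem_insert e C.1)
    have hle : (⟨_, hconf⟩ : 𝓔.Domain) ≤ D := Set.insert_subset heD hsub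
    exact congrArg Subtype.val (hle.eq_of_not_lt (h.2 hlt)).symm
  · rintro ⟨e, he, heq⟩
    have hcov : C.1 ⋖ D.1 := Set.covBy_iff_exists_insert.2 ⟨e, he, heq.symm⟩
    exact ⟨hcov.1, fun F h₁ h₂ => hcov.2 h₁ h₂⟩

/-! ### Transport of event structures along bijections -/

/-- The event structure transported along a bijection between the sets of events. -/
def comap {E' : Type*} (𝓔 : EventStructure E) (θ : E' ≃ E) : EventStructure E' where
  le a b := 𝓔.le (θ a) (θ b)
  le_refl a := 𝓔.le_refl _
  le_trans a b c := 𝓔.le_trans _ _ _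
  le_antisymm a b h h' := θ.injective (𝓔.le_antisymm _ _ h h')
  conflict a b := 𝓔.conflict (θ a) (θ b)
  conflict_irrefl a := 𝓔.conflict_irrefl _
  conflict_symm a b := 𝓔.conflict_symm _ _
  conflict_hered a b c := 𝓔.conflict_hered _ _ _
  finitary e := (𝓔.finitary (θ e)).preimage θ.injective.injOn

variable {E' : Type*} (θ : E' ≃ E)

theorem independent_comap_iff {a b : E'} :
    (𝓔.comap θ).Independent a b ↔ 𝓔.Independent (θ a) (θ b) := by
  refine or_congr Iff.rfl (and_congr Iff.rfl (not_congr ?_))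
  constructor
  · rintro ⟨e, h₁, h₂, h₃⟩
    exact ⟨θ e, θ.injective.ne h₁, θ.injective.ne h₂, h₃⟩
  · rintro ⟨e, h₁, h₂, h₃⟩
    obtain ⟨e, rfl⟩ := θ.surjective e
    exact ⟨e, fun h => h₁ (h ▸ rfl), fun h => h₂ (h ▸ rfl), h₃⟩

theorem degree_comap : (𝓔.comap θ).degree = 𝓔.degree := by
  unfold degree
  congr 1
  ext k
  constructor
  · rintro ⟨s, hs, rfl⟩
    refine ⟨θ '' s, ?_, θ.injective.encard_image s⟩
    rintro _ ⟨a, ha, rfl⟩ _ ⟨b, hb, rfl⟩ hne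
    exact (independent_comap_iff θ).1 (hs ha hb fun h => hne (h ▸ rfl))
  · rintro ⟨s, hs, rfl⟩
    refine ⟨θ.symm '' s, ?_, θ.symm.injective.encard_image s⟩
    rintro _ ⟨a, ha, rfl⟩ _ ⟨b, hb, rfl⟩ hne
    rw [independent_comap_iff, θ.apply_symm_apply, θ.apply_symm_apply]
    exact hs ha hb fun h => hne (h ▸ rfl)

theorem isConfiguration_comap_iff {C : Set E} :
    (𝓔.comap θ).IsConfiguration (θ ⁻¹' C) ↔ 𝓔.IsConfiguration C := by
  refine and_congr ?_ ?_
  · constructor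
    · intro h a ha b hb
      simpa [comap] using h (θ.symm a) (by simpa) (θ.symm b) (by simpa)
    · exact fun h a ha b hb => h _ ha _ hb
  · constructor
    · intro h a ha b hb
      simpa using h (θ.symm a) (by simpa) (θ.symm b) (show 𝓔.le (θ _) (θ _) by simpa)
    · exact fun h a ha b hb => h _ ha _ hb

/-- The domain of a transported event structure. -/
def domainComap : (𝓔.comap θ).Domain ≃o 𝓔.Domain where
  toFun C := ⟨θ.symm ⁻¹' C.1, by
    rw [← isConfiguration_comap_iff θ, ← Set.preimage_comp, θ.symm_comp_self]
    exact C.2⟩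
  invFun C := ⟨θ ⁻¹' C.1, (isConfiguration_comap_iff θ).2 C.2⟩
  left_inv C := Subtype.ext (by simp [← Set.preimage_comp])
  right_inv C := Subtype.ext (by simp [← Set.preimage_comp])
  map_rel_iff' {C D} := θ.symm.surjective.preimage_subset_preimage_iff

end EventStructure

/-! ### The graph of the domain of a finite event structure -/

/-- The graph `G` is, through the bijection `φ`, the graph of the domain of `𝓔`: two vertices are
adjacent when the corresponding configurations differ in exactly one event. -/
def SimpleGraph.IsDomainGraph {V E : Type*} (G : SimpleGraph V) {𝓔 : EventStructure E}
    (φ : V ≃ 𝓔.Domain) : Prop :=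
  ∀ u v, G.Adj u v ↔ ∃ e, symmDiff (φ u).1 (φ v).1 = {e}

namespace Set

variable {E : Type*} [Finite E]

theorem ncard_symmDiff_singleton_of_mem {A : Set E} {e : E} (h : e ∈ A) :
    (symmDiff A {e}).ncard + 1 = A.ncard := by
  rw [symmDiff_singleton_of_mem h, ncard_sdiff_singleton_add_one h]

theorem ncard_symmDiff_singleton_of_notMem {A : Set E} {e : E} (h : e ∉ A) :
    (symmDiff A {e}).ncard = A.ncard + 1 := by
  rw [symmDiff_singleton_of_notMem h, ncard_insert_of_notMem h]

theorem ncard_symmDiff_add_two_mul_ncard_inter (A B : Set E) :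
    (symmDiff A B).ncard + 2 * (A ∩ B).ncard = A.ncard + B.ncard := by
  have h₁ := ncard_union_add_ncard_inter A B
  have h₂ := ncard_sdiff_add_ncard_of_subset (inter_subset_left.trans subset_union_left :
    A ∩ B ⊆ A ∪ B)
  have h₃ : symmDiff A B = (A ∪ B) \ (A ∩ B) := symmDiff_eq_sup_sdiff_inf A B
  rw [h₃]
  omega

/-- Whether the four distances between the ends of two edges, labelled by the events `e` and `f`,
are balanced depends only on whether `e = f`. -/
theorem ncard_symmDiff_singleton_balance (A : Set E) (e f : E) :
    A.ncard + (symmDiff (symmDiff A {e}) {f}).ncard ≠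
      (symmDiff A {f}).ncard + (symmDiff A {e}).ncard ↔ e = f := by
  by_cases hef : e = f
  · subst hef
    rw [symmDiff_assoc, symmDiff_self, symmDiff_bot]
    by_cases h : e ∈ A
    · have := ncard_symmDiff_singleton_of_mem h
      exact iff_of_true (by omega) rfl
    · have := ncard_symmDiff_singleton_of_notMem h
      exact iff_of_true (by omega) rfl
  · refine iff_of_false ?_ hef
    have hmem : f ∈ symmDiff A {e} ↔ f ∈ A := by
      simp only [mem_symmDiff, mem_singleton_iff]
      grind
    by_cases hf : f ∈ A
    · have h₁ := ncard_symmDiff_singleton_of_mem hf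
      have h₂ := ncard_symmDiff_singleton_of_mem (hmem.2 hf)
      omega
    · have h₁ := ncard_symmDiff_singleton_of_notMem hf
      have h₂ := ncard_symmDiff_singleton_of_notMem fun h => hf (hmem.1 h)
      omega

end Set

namespace SimpleGraph.IsDomainGraph

open EventStructure

variable {V E : Type*} [Finite E] {G : SimpleGraph V} {𝓔 : EventStructure E} {φ : V ≃ 𝓔.Domain}


/-- Two configurations are joined by a walk that adds or removes each event on which they differ
exactly once. -/
theorem exists_walk (hG : G.IsDomainGraph φ) (n : ℕ) (u v : V)
    (hn : (symmDiff (φ u).1 (φ v).1).ncard = n) :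
    ∃ p : G.Walk u v, p.length = n := by
  induction n generalizing u with
  | zero =>
    rw [Set.ncard_eq_zero, ← Set.bot_eq_empty, symmDiff_eq_bot] at hn
    obtain rfl : u = v := φ.injective (Subtype.ext hn)
    exact ⟨.nil, rfl⟩
  | succ n ih =>
    obtain ⟨e, he, hconf⟩ := exists_isConfiguration_symmDiff (φ u).2 (φ v).2 fun h => by
      rw [h, symmDiff_self, Set.bot_eq_empty, Set.ncard_empty] at hn
      omega
    obtain ⟨p, hp⟩ := ih (φ.symm ⟨_, hconf⟩) (by
      rw [φ.apply_symm_apply, symmDiff_right_comm]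
      have := Set.ncard_symmDiff_singleton_of_mem he
      omega)
    refine ⟨.cons ((hG _ _).2 ⟨e, ?_⟩) p, by simp [hp]⟩
    rw [φ.apply_symm_apply, symmDiff_symmDiff_cancel_left]

theorem ncard_le_length (hG : G.IsDomainGraph φ) {u v : V} (p : G.Walk u v) :
    (symmDiff (φ u).1 (φ v).1).ncard ≤ p.length := by
  induction p with
  | nil => simp
  | @cons u w v h p ih =>
    obtain ⟨e, he⟩ := (hG _ _).1 h
    have h₁ : (symmDiff (φ u).1 (φ v).1).ncard ≤
        (symmDiff (φ u).1 (φ w).1 ∪ symmDiff (φ w).1 (φ v).1).ncard :=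
      Set.ncard_le_ncard (symmDiff_triangle (φ u).1 (φ w).1 (φ v).1)
    have h₂ := Set.ncard_union_le (symmDiff (φ u).1 (φ w).1) (symmDiff (φ w).1 (φ v).1)
    have h₃ : (symmDiff (φ u).1 (φ w).1).ncard = 1 := by rw [he, Set.ncard_singleton]
    rw [Walk.length_cons]
    omega

theorem connected (hG : G.IsDomainGraph φ) : G.Connected := by
  have : Nonempty V := ⟨φ.symm ⟨∅, by simp [IsConfiguration]⟩⟩
  exact ⟨fun u v => ⟨(hG.exists_walk _ u v rfl).choose⟩⟩

theorem dist_eq (hG : G.IsDomainGraph φ) (u v : V) :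
    G.dist u v = (symmDiff (φ u).1 (φ v).1).ncard := by
  obtain ⟨p, hp⟩ := hG.exists_walk _ u v rfl
  obtain ⟨q, hq⟩ := (hG.connected.preconnected u v).exists_walk_length_eq_dist
  have h₁ := hG.ncard_le_length q
  have h₂ := dist_le p
  omega

/-- An interval consists of the configurations between the intersection and the union of its
ends. -/
theorem mem_interval_iff (hG : G.IsDomainGraph φ) {u v x : V} : x ∈ G.interval u v ↔
    ∀ e, (e ∈ (φ u).1 → e ∈ (φ v).1 → e ∈ (φ x).1) ∧
      (e ∈ (φ x).1 → e ∈ (φ u).1 ∨ e ∈ (φ v).1) := by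
  have h := Set.ncard_symmDiff_add_two_mul_ncard_inter (symmDiff (φ u).1 (φ x).1)
    (symmDiff (φ x).1 (φ v).1)
  rw [symmDiff_assoc, symmDiff_symmDiff_cancel_left] at h
  have h' : x ∈ G.interval u v ↔
      symmDiff (φ u).1 (φ x).1 ∩ symmDiff (φ x).1 (φ v).1 = ∅ := by
    rw [← Set.ncard_eq_zero]
    change _ = _ ↔ _
    rw [hG.dist_eq, hG.dist_eq, hG.dist_eq]
    omega
  rw [h', Set.eq_empty_iff_forall_notMem]
  refine forall_congr' fun e => ?_
  simp only [Set.mem_inter_iff, Set.mem_symmDiff]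
  tauto

theorem isMedian (hG : G.IsDomainGraph φ) : G.IsMedian := by
  refine ⟨hG.connected, fun x y z => ?_⟩
  refine ⟨φ.symm ⟨_, isConfiguration_majority (φ x).2 (φ y).2 (φ z).2⟩, ?_, ?_⟩
  · simp only [Set.mem_inter_iff, hG.mem_interval_iff, φ.apply_symm_apply, Set.mem_union]
    refine ⟨⟨fun e => ?_, fun e => ?_⟩, fun e => ?_⟩ <;> tauto
  · rintro w ⟨⟨h₁, h₂⟩, h₃⟩
    rw [hG.mem_interval_iff] at h₁ h₂ h₃
    rw [Equiv.eq_symm_apply]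
    refine Subtype.ext (Set.ext fun e => ?_)
    have h₁ := h₁ e
    have h₂ := h₂ e
    have h₃ := h₃ e
    simp only [Set.mem_inter_iff, Set.mem_union]
    constructor
    · intro hw
      rcases h₁.2 hw with hx | hy
      · rcases h₂.2 hw with hy | hz
        · exact .inl (.inl ⟨hx, hy⟩)
        · exact .inr ⟨hz, hx⟩
      · rcases h₃.2 hw with hz | hx
        · exact .inl (.inr ⟨hy, hz⟩)
        · exact .inl (.inl ⟨hx, hy⟩)
    · rintro ((h | h) | h)
      exacts [h₁.1 h.1 h.2, h₂.1 h.1 h.2, h₃.1 h.1 h.2]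

/-! ### Parallelism classes of the domain graph -/

theorem thetaRel_iff (hG : G.IsDomainGraph φ) {x y z w : V} {e f : E}
    (he : symmDiff (φ x).1 (φ y).1 = {e}) (hf : symmDiff (φ z).1 (φ w).1 = {f}) :
    G.dist x z + G.dist y w ≠ G.dist x w + G.dist y z ↔ e = f := by
  have hy : (φ y).1 = symmDiff (φ x).1 {e} := by rw [← he, symmDiff_symmDiff_cancel_left]
  have hw : (φ w).1 = symmDiff (φ z).1 {f} := by rw [← hf, symmDiff_symmDiff_cancel_left]
  rw [hG.dist_eq, hG.dist_eq, hG.dist_eq, hG.dist_eq, hy, hw,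
    ← Set.ncard_symmDiff_singleton_balance (symmDiff (φ x).1 (φ z).1), ← symmDiff_assoc,
    symmDiff_right_comm (φ x).1 {e}, ← symmDiff_assoc]

omit [Finite E] in
theorem exists_edge_label (hG : G.IsDomainGraph φ) (d : G.edgeSet) :
    ∃ e, ∀ x y, (d : Sym2 V) = s(x, y) → symmDiff (φ x).1 (φ y).1 = {e} := by
  obtain ⟨d, hd⟩ := d
  induction d with
  | h x y =>
    obtain ⟨e, he⟩ := (hG x y).1 hd
    refine ⟨e, fun x' y' h => ?_⟩
    rcases Sym2.eq_iff.1 h with ⟨rfl, rfl⟩ | ⟨rfl, rfl⟩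
    · exact he
    · rwa [symmDiff_comm]

/-- The label of an edge of the domain graph: the event that is added along the edge. -/
noncomputable def edgeLabel (hG : G.IsDomainGraph φ) (d : G.edgeSet) : E :=
  (hG.exists_edge_label d).choose

omit [Finite E] in
theorem edgeLabel_spec (hG : G.IsDomainGraph φ) (d : G.edgeSet) (x y : V)
    (h : (d : Sym2 V) = s(x, y)) :
    symmDiff (φ x).1 (φ y).1 = {hG.edgeLabel d} :=
  (hG.exists_edge_label d).choose_spec x y h

theorem edgeLabel_eq_iff (hG : G.IsDomainGraph φ) (d d' : G.edgeSet) :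
    hG.edgeLabel d = hG.edgeLabel d' ↔ G.ThetaRel d d' := by
  constructor
  · intro h
    obtain ⟨⟨d, hd⟩, d', hd'⟩ := d, d'
    induction d with
    | h x y =>
      induction d' with
      | h z w =>
        exact ⟨x, y, z, w, rfl, rfl, (hG.thetaRel_iff (hG.edgeLabel_spec _ x y rfl)
          (hG.edgeLabel_spec _ z w rfl)).2 h⟩
  · rintro ⟨x, y, z, w, h, h', hne⟩
    exact (hG.thetaRel_iff (hG.edgeLabel_spec _ x y h) (hG.edgeLabel_spec _ z w h')).1 hne

omit [Finite E] in
/-- The edge that adds `e` to the set of the events strictly below it is labelled by `e`. -/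
theorem exists_edgeLabel_eq (hG : G.IsDomainGraph φ) (e : E) : ∃ d, hG.edgeLabel d = e := by
  have h : symmDiff (φ (φ.symm ⟨_, isConfiguration_below (.inl (Eq.refl e))⟩)).1
      (φ (φ.symm ⟨_, isConfiguration_insert_below (.inl (Eq.refl e))⟩)).1 = {e} := by
    simp only [φ.apply_symm_apply]
    exact Set.symmDiff_insert_self (notMem_below_left e e)
  refine ⟨⟨s(_, _), (hG _ _).2 ⟨e, h⟩⟩, ?_⟩
  rw [← Set.singleton_eq_singleton_iff, ← h]
  exact (hG.edgeLabel_spec _ _ _ rfl).symm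

/-- The parallelism classes of the domain graph are in bijection with the events. -/
noncomputable def thetaEquiv (hG : G.IsDomainGraph φ) : G.ThetaClass ≃ E :=
  Equiv.ofBijective (Quot.lift hG.edgeLabel fun d d' h => (hG.edgeLabel_eq_iff d d').2 h) <| by
    constructor
    · rintro ⟨d⟩ ⟨d'⟩ h
      exact Quot.sound ((hG.edgeLabel_eq_iff d d').1 h)
    · intro e
      obtain ⟨d, hd⟩ := hG.exists_edgeLabel_eq e
      exact ⟨Quot.mk _ d, hd⟩

theorem has_iff (hG : G.IsDomainGraph φ) {i : G.ThetaClass} {x y : V} :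
    i.Has x y ↔ symmDiff (φ x).1 (φ y).1 = {hG.thetaEquiv i} := by
  constructor
  · rintro ⟨h, rfl⟩
    exact hG.edgeLabel_spec _ x y rfl
  · intro h
    have hadj : G.Adj x y := (hG _ _).2 ⟨_, h⟩
    refine ⟨hadj, hG.thetaEquiv.injective ?_⟩
    rw [← Set.singleton_eq_singleton_iff, ← h]
    exact (hG.edgeLabel_spec ⟨s(x, y), hadj⟩ x y rfl).symm

end SimpleGraph.IsDomainGraph

/-! ### The event structure associated with the domain graph -/

namespace SimpleGraph.IsDomainGraph

open EventStructure

variable {V E : Type*} [Finite E] {G : SimpleGraph V} {𝓔 : EventStructure E} {φ : V ≃ 𝓔.Domain}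

theorem mem_iff_of_has (hG : G.IsDomainGraph φ) {i : G.ThetaClass} {x y : V} (h : i.Has x y)
    (e : E) : e ∈ (φ y).1 ↔ (e ∈ (φ x).1 ↔ e ≠ hG.thetaEquiv i) :=
  Set.mem_iff_of_symmDiff_eq_singleton (hG.has_iff.1 h) e

/-- The squares of the domain graph come from pairs of concurrent events. -/
theorem cross_iff (hG : G.IsDomainGraph φ) {i j : G.ThetaClass} :
    G.Cross i j ↔ 𝓔.Concurrent (hG.thetaEquiv i) (hG.thetaEquiv j) := by
  constructor
  · rintro ⟨a, b, c, d, ⟨-, -, -, -, hac, -⟩, hab, hcd, hbc, hda⟩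
    have hij : i ≠ j := by
      rintro rfl
      refine hac (φ.injective (Subtype.ext (Set.ext fun e => ?_)))
      rw [hG.mem_iff_of_has hbc, hG.mem_iff_of_has hab]
      tauto
    have hne := hG.thetaEquiv.injective.ne hij
    -- the four vertices of the square contain the two events in all four possible ways
    have hb₁ := hG.mem_iff_of_has hab (hG.thetaEquiv i)
    have hb₂ := hG.mem_iff_of_has hab (hG.thetaEquiv j)
    have hc₁ := hG.mem_iff_of_has hbc (hG.thetaEquiv i)
    have hc₂ := hG.mem_iff_of_has hbc (hG.thetaEquiv j)
    have hd₁ := hG.mem_iff_of_has hcd (hG.thetaEquiv i)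
    have hd₂ := hG.mem_iff_of_has hcd (hG.thetaEquiv j)
    have h₁ : ∃ v, hG.thetaEquiv i ∉ (φ v).1 ∧ hG.thetaEquiv j ∈ (φ v).1 := by
      by_contra! h
      have := h a
      have := h b
      have := h c
      have := h d
      grind
    have h₂ : ∃ v, hG.thetaEquiv i ∈ (φ v).1 ∧ hG.thetaEquiv j ∉ (φ v).1 := by
      by_contra! h
      have := h a
      have := h b
      have := h c
      have := h d
      grind
    have h₃ : ∃ v, hG.thetaEquiv i ∈ (φ v).1 ∧ hG.thetaEquiv j ∈ (φ v).1 := by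
      by_contra! h
      have := h a
      have := h b
      have := h c
      have := h d
      grind
    obtain ⟨v₁, hi₁, hj₁⟩ := h₁
    obtain ⟨v₂, hi₂, hj₂⟩ := h₂
    obtain ⟨v₃, hi₃, hj₃⟩ := h₃
    exact ⟨fun h => hi₁ ((φ v₁).2.2 _ hj₁ _ h), fun h => hj₂ ((φ v₂).2.2 _ hi₂ _ h),
      fun h => (φ v₃).2.1 _ hi₃ _ hj₃ h⟩
  · intro h
    have hind : 𝓔.Independent _ _ := .inl h
    set e := hG.thetaEquiv i with he
    set f := hG.thetaEquiv j with hf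
    have hef : e ≠ f := hind.ne
    set C := 𝓔.below e f with hC
    have hCe : 𝓔.IsConfiguration (insert e C) := isConfiguration_insert_below (.inr hind)
    have hCf : 𝓔.IsConfiguration (insert f C) := by
      rw [hC, below_comm]
      exact isConfiguration_insert_below (.inr hind.symm)
    have hCef : 𝓔.IsConfiguration (insert f (insert e C)) := by
      have hc : ¬ 𝓔.conflict e f := h.2.2
      constructor
      · have hfx : ∀ x ∈ insert e C, ¬ 𝓔.conflict f x := by
          rintro x (rfl | hx) hfx
          · exact hc (𝓔.conflict_symm _ _ hfx)
          · exact hCf.1 f (.inl rfl) x (.inr hx) hfx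
        rintro x (rfl | hx) y (rfl | hy) hxy
        · exact 𝓔.conflict_irrefl _ hxy
        · exact hfx y hy hxy
        · exact hfx x hx (𝓔.conflict_symm _ _ hxy)
        · exact hCe.1 x hx y hy hxy
      · rintro x (rfl | hx) y hy
        · exact (hCf.2 _ (.inl rfl) y hy).imp_right .inr
        · exact .inr (hCe.2 x hx y hy)
    have heC : e ∉ C := notMem_below_left e f
    have hfC : f ∉ C := notMem_below_right e f
    have hfC' : f ∉ insert e C := fun h => h.elim (fun h => hef h.symm) hfC
    have heC' : e ∉ insert f C := fun h => h.elim hef heC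
    have h₁ : symmDiff (φ (φ.symm ⟨C, isConfiguration_below (.inr hind)⟩)).1
        (φ (φ.symm ⟨_, hCe⟩)).1 = {e} := by
      simpa only [φ.apply_symm_apply] using Set.symmDiff_insert_self heC
    have h₂ : symmDiff (φ (φ.symm ⟨_, hCe⟩)).1 (φ (φ.symm ⟨_, hCef⟩)).1 = {f} := by
      simpa only [φ.apply_symm_apply] using Set.symmDiff_insert_self hfC'
    have h₃ : symmDiff (φ (φ.symm ⟨_, hCef⟩)).1 (φ (φ.symm ⟨_, hCf⟩)).1 = {e} := by
      simp only [φ.apply_symm_apply]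
      rw [symmDiff_comm, Set.insert_comm]
      exact Set.symmDiff_insert_self heC'
    have h₄ : symmDiff (φ (φ.symm ⟨_, hCf⟩)).1
        (φ (φ.symm ⟨C, isConfiguration_below (.inr hind)⟩)).1 = {f} := by
      simp only [φ.apply_symm_apply]
      rw [symmDiff_comm]
      exact Set.symmDiff_insert_self hfC
    refine ⟨_, _, _, _, ⟨(hG _ _).2 ⟨_, h₁⟩, (hG _ _).2 ⟨_, h₂⟩, (hG _ _).2 ⟨_, h₃⟩,
      (hG _ _).2 ⟨_, h₄⟩, ?_, ?_⟩, hG.has_iff.2 h₁, hG.has_iff.2 h₃, hG.has_iff.2 h₂,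
      hG.has_iff.2 h₄⟩
    · rw [φ.symm.injective.ne_iff]
      exact fun h => hfC ((congrArg (f ∈ ·.1) h).mpr (Set.mem_insert f _))
    · rw [φ.symm.injective.ne_iff]
      exact fun h => hfC' ((congrArg (f ∈ ·.1) h).mpr (Set.mem_insert f _))

variable {α : V}

theorem dist_eq_ncard (hG : G.IsDomainGraph φ) (hα : (φ α).1 = ∅) (u : V) :
    G.dist α u = (φ u).1.ncard := by
  rw [hG.dist_eq, hα, ← Set.bot_eq_empty, bot_symmDiff]

/-- The arcs of the pointed graph add one event. -/
theorem pointedArc_iff (hG : G.IsDomainGraph φ) (hα : (φ α).1 = ∅) {u v : V} :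
    G.PointedArc α u v ↔ ∃ e ∉ (φ u).1, (φ v).1 = insert e (φ u).1 := by
  unfold PointedArc
  rw [hG.dist_eq_ncard hα, hG.dist_eq_ncard hα, hG]
  constructor
  · rintro ⟨⟨e, he⟩, hlt⟩
    have hv : (φ v).1 = symmDiff (φ u).1 {e} := by rw [← he, symmDiff_symmDiff_cancel_left]
    have heu : e ∉ (φ u).1 := by
      intro heu
      have := Set.ncard_symmDiff_singleton_of_mem heu
      rw [hv] at hlt
      omega
    refine ⟨e, heu, ?_⟩
    rw [hv, Set.symmDiff_singleton_of_notMem heu]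
  · rintro ⟨e, he, hv⟩
    refine ⟨⟨e, by rw [hv, Set.symmDiff_insert_self he]⟩, ?_⟩
    rw [hv, Set.ncard_insert_of_notMem he]
    omega

theorem pointedArc_iff_covBy (hG : G.IsDomainGraph φ) (hα : (φ α).1 = ∅) {u v : V} :
    G.PointedArc α u v ↔ φ u ⋖ φ v := by
  rw [hG.pointedArc_iff hα, covBy_iff_insert]

theorem farHalfspace_eq (hG : G.IsDomainGraph φ) (hα : (φ α).1 = ∅) (i : G.ThetaClass) :
    G.farHalfspace α i = {z | hG.thetaEquiv i ∈ (φ z).1} := by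
  have key : ∀ x y z, hG.thetaEquiv i ∉ (φ x).1 → (φ y).1 = insert (hG.thetaEquiv i) (φ x).1 →
      (G.dist z y < G.dist z x ↔ hG.thetaEquiv i ∈ (φ z).1) := by
    intro x y z hx hy
    have hy' : (φ y).1 = symmDiff (φ x).1 {hG.thetaEquiv i} := by
      rw [← Set.symmDiff_insert_self hx, symmDiff_symmDiff_cancel_left, hy]
    rw [hG.dist_eq, hG.dist_eq, hy', ← symmDiff_assoc]
    by_cases hz : hG.thetaEquiv i ∈ (φ z).1
    · have := Set.ncard_symmDiff_singleton_of_mem (A := symmDiff (φ z).1 (φ x).1) (.inl ⟨hz, hx⟩)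
      exact iff_of_true (by omega) hz
    · have := Set.ncard_symmDiff_singleton_of_notMem (A := symmDiff (φ z).1 (φ x).1)
        (e := hG.thetaEquiv i) (by rintro (h | h); exacts [hz h.1, hx h.1])
      exact iff_of_false (by omega) hz
  ext z
  constructor
  · rintro ⟨x, y, harc, hi, hlt⟩
    obtain ⟨e, he, hy⟩ := (hG.pointedArc_iff hα).1 harc
    have heq := hG.has_iff.1 hi
    rw [hy, Set.symmDiff_insert_self he, Set.singleton_eq_singleton_iff] at heq
    subst heq
    exact (key x y z he hy).1 hlt
  · intro hz
    have hx := isConfiguration_below (𝓔 := 𝓔) (.inl (Eq.refl (hG.thetaEquiv i)))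
    have hy := isConfiguration_insert_below (𝓔 := 𝓔) (.inl (Eq.refl (hG.thetaEquiv i)))
    have hn := notMem_below_left (𝓔 := 𝓔) (hG.thetaEquiv i) (hG.thetaEquiv i)
    refine ⟨φ.symm ⟨_, hx⟩, φ.symm ⟨_, hy⟩, (hG.pointedArc_iff hα).2 ⟨hG.thetaEquiv i, ?_, ?_⟩,
      hG.has_iff.2 ?_, (key _ _ z ?_ ?_).2 hz⟩
    all_goals simp only [φ.apply_symm_apply]
    · exact hn
    · exact Set.symmDiff_insert_self hn
    · exact hn

theorem separates_iff (hG : G.IsDomainGraph φ) (hα : (φ α).1 = ∅) {i j : G.ThetaClass} :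
    G.Separates α i j ↔ i ≠ j ∧ 𝓔.le (hG.thetaEquiv i) (hG.thetaEquiv j) := by
  unfold Separates
  rw [hG.cross_iff, hG.farHalfspace_eq hα]
  constructor
  · rintro ⟨-, h⟩
    -- the edge that adds the event of `j` to the set of all the events strictly below it
    have hx := isConfiguration_below (𝓔 := 𝓔) (.inl (Eq.refl (hG.thetaEquiv j)))
    have hy := isConfiguration_insert_below (𝓔 := 𝓔) (.inl (Eq.refl (hG.thetaEquiv j)))
    have hn := notMem_below_left (𝓔 := 𝓔) (hG.thetaEquiv j) (hG.thetaEquiv j)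
    have := (h (φ.symm ⟨_, hx⟩) (φ.symm ⟨_, hy⟩) (hG.has_iff.2 (by
      simpa only [φ.apply_symm_apply] using Set.symmDiff_insert_self hn))).1
    simp only [Set.mem_ofPred_eq, φ.apply_symm_apply] at this
    exact ⟨fun h => this.2.1 (h ▸ rfl), this.1.elim id id⟩
  · rintro ⟨hne, hle⟩
    refine ⟨fun h => h.1 hle, fun x y hj => ?_⟩
    have hne' := hG.thetaEquiv.injective.ne hne
    have hi := hG.mem_iff_of_has hj (hG.thetaEquiv i)
    have hj := hG.mem_iff_of_has hj (hG.thetaEquiv j)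
    have hx := fun h => (φ x).2.2 _ h _ hle
    have hy := fun h => (φ y).2.2 _ h _ hle
    simp only [Set.mem_ofPred_eq]
    tauto

/-- Up to the bijection between classes and events, the event structure associated with the domain
graph pointed at the empty configuration is the given one. -/
theorem isAssociated (hG : G.IsDomainGraph φ) (hα : (φ α).1 = ∅) :
    (𝓔.comap hG.thetaEquiv).IsAssociated G α := by
  have hle : ∀ i j, (𝓔.comap hG.thetaEquiv).le i j ↔
    𝓔.le (hG.thetaEquiv i) (hG.thetaEquiv j) := fun i j => Iff.rfl
  have hc : ∀ i j, (𝓔.comap hG.thetaEquiv).conflict i j ↔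
    𝓔.conflict (hG.thetaEquiv i) (hG.thetaEquiv j) := fun i j => Iff.rfl
  constructor
  · intro i j
    rw [hG.separates_iff hα, hle]
    constructor
    · exact fun h => or_iff_not_imp_left.2 fun hne => ⟨hne, h⟩
    · rintro (rfl | h)
      · exact 𝓔.le_refl _
      · exact h.2
  · intro i j
    rw [hG.separates_iff hα, hG.separates_iff hα, hG.cross_iff, hc]
    constructor
    · intro h
      refine ⟨?_, fun h' => h'.2.2 h, fun h' => 𝓔.not_conflict_of_le h'.2 (𝓔.le_refl _) h,
        fun h' => 𝓔.not_conflict_of_le (𝓔.le_refl _) h'.2 h⟩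
      rintro rfl
      exact 𝓔.conflict_irrefl _ h
    · rintro ⟨hne, h₁, h₂, h₃⟩
      by_contra h
      exact h₁ ⟨fun h' => h₂ ⟨hne, h'⟩, fun h' => h₃ ⟨hne.symm, h'⟩, h⟩

/-- The Hasse diagram of the domain of the associated event structure is the pointed graph. -/
theorem nonempty_covBy_relIso (hG : G.IsDomainGraph φ) (hα : (φ α).1 = ∅) :
    Nonempty (((· ⋖ ·) : (𝓔.comap hG.thetaEquiv).Domain → _ → Prop) ≃r G.PointedArc α) := by
  refine ⟨⟨(domainComap hG.thetaEquiv).toEquiv.trans φ.symm, fun {C D} => ?_⟩⟩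
  rw [hG.pointedArc_iff_covBy hα]
  simp only [Equiv.trans_apply, φ.apply_symm_apply]
  exact apply_covBy_apply_iff (domainComap hG.thetaEquiv)

/-! ### Independent events and contacts -/

/-- Independent events can be added to the same configuration. -/
theorem exists_common_origin (hG : G.IsDomainGraph φ) (hα : (φ α).1 = ∅) {i j : G.ThetaClass}
    (h : 𝓔.Independent (hG.thetaEquiv i) (hG.thetaEquiv j)) :
    ∃ o a b, G.PointedArc α o a ∧ G.PointedArc α o b ∧ i.Has o a ∧ j.Has o b := by
  have hCf := isConfiguration_insert_below (.inr h.symm)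
  rw [below_comm] at hCf
  have he := notMem_below_left (𝓔 := 𝓔) (hG.thetaEquiv i) (hG.thetaEquiv j)
  have hf := notMem_below_right (𝓔 := 𝓔) (hG.thetaEquiv i) (hG.thetaEquiv j)
  refine ⟨φ.symm ⟨_, isConfiguration_below (.inr h)⟩,
    φ.symm ⟨_, isConfiguration_insert_below (.inr h)⟩, φ.symm ⟨_, hCf⟩,
    (hG.pointedArc_iff hα).2 ⟨hG.thetaEquiv i, ?_, ?_⟩,
    (hG.pointedArc_iff hα).2 ⟨hG.thetaEquiv j, ?_, ?_⟩,
    hG.has_iff.2 ?_, hG.has_iff.2 ?_⟩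
  any_goals simp only [φ.apply_symm_apply]
  · exact he
  · exact hf
  · exact Set.symmDiff_insert_self he
  · exact Set.symmDiff_insert_self hf


/-- The ends of an edge belong to the carrier of its class: the edge is a cube of dimension one. -/
theorem _root_.SimpleGraph.mem_carrier_of_has {i : G.ThetaClass} {o a : V} (h : i.Has o a) :
    o ∈ G.carrier i := by
  obtain ⟨hadj, hi⟩ := h
  let f : cube 1 ↪g G :=
    { toFun := fun s => if s 0 then a else o
      inj' := fun s t hst => by
        ext k
        obtain rfl : k = 0 := Subsingleton.elim _ _
        have := hadj.ne
        cases hs : s 0 <;> cases ht : t 0 <;> simp_all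
      map_rel_iff' := fun {s t} => by
        have := hadj.symm
        change G.Adj (if s 0 then a else o) (if t 0 then a else o) ↔ hammingDist s t = 1
        cases hs : s 0 <;> cases ht : t 0 <;> simp_all [hammingDist, Finset.filter_singleton] }
  exact ⟨1, f, ⟨fun _ => false, rfl⟩, fun _ => false, fun _ => true, hadj, hi⟩

theorem contactGraph_adj (hG : G.IsDomainGraph φ) (hα : (φ α).1 = ∅) {i j : G.ThetaClass}
    (h : 𝓔.Independent (hG.thetaEquiv i) (hG.thetaEquiv j)) : G.contactGraph.Adj i j := by
  obtain ⟨o, a, b, -, -, ha, hb⟩ := hG.exists_common_origin hα h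
  exact ⟨fun hij => h.ne (hij ▸ rfl), o, mem_carrier_of_has ha, mem_carrier_of_has hb⟩

theorem pointedContactGraph_adj (hG : G.IsDomainGraph φ) (hα : (φ α).1 = ∅) {i j : G.ThetaClass}
    (h : 𝓔.Independent (hG.thetaEquiv i) (hG.thetaEquiv j)) :
    (G.pointedContactGraph α).Adj i j := by
  refine ⟨fun hij => h.ne (hij ▸ rfl), ?_⟩
  rcases h with h | h
  · exact .inl (hG.cross_iff.2 h)
  obtain ⟨o, a, b, hoa, hob, ha, hb⟩ := hG.exists_common_origin hα (.inr h)
  refine .inr ⟨o, a, b, hoa, hob, ha, hb, ?_⟩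
  -- a square on the two arcs would make the classes cross
  rintro ⟨c, h₁, h₂, h₃, h₄, h₅, h₆⟩
  obtain ⟨g, hg⟩ := (hG _ _).1 h₂
  obtain ⟨g', hg'⟩ := (hG _ _).1 h₃
  have ha' := hG.mem_iff_of_has ha
  have hb' := hG.mem_iff_of_has hb
  have hac : ∀ x, x ∈ (φ c).1 ↔ (x ∈ (φ a).1 ↔ x ≠ g) :=
    Set.mem_iff_of_symmDiff_eq_singleton hg
  have hcb : ∀ x, x ∈ (φ b).1 ↔ (x ∈ (φ c).1 ↔ x ≠ g') :=
    Set.mem_iff_of_symmDiff_eq_singleton hg'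
  have hne : hG.thetaEquiv i ≠ hG.thetaEquiv j := Independent.ne (.inr h)
  have hgi : g ≠ hG.thetaEquiv i := by
    rintro rfl
    refine h₅ (φ.injective (Subtype.ext (Set.ext fun x => ?_)))
    have := hac x
    have := ha' x
    grind
  obtain ⟨e, he, hea⟩ := (hG.pointedArc_iff hα).1 hoa
  obtain ⟨f, hf, hfb⟩ := (hG.pointedArc_iff hα).1 hob
  have hea' := hG.has_iff.1 ha
  have hfb' := hG.has_iff.1 hb
  rw [hea, Set.symmDiff_insert_self he, Set.singleton_eq_singleton_iff] at hea'
  rw [hfb, Set.symmDiff_insert_self hf, Set.singleton_eq_singleton_iff] at hfb'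
  subst hea' hfb'
  have key : ∀ x, x ∈ ({g, hG.thetaEquiv i} : Set E) → x = hG.thetaEquiv j ∨ x = g' := by
    intro x hx
    have := hac x
    have := hcb x
    have := ha' x
    have := hb' x
    simp only [Set.mem_insert_iff, Set.mem_singleton_iff] at hx
    grind
  have hg'i : g' = hG.thetaEquiv i := ((key _ (.inr rfl)).resolve_left hne).symm
  have hgj : g = hG.thetaEquiv j :=
    (key _ (.inl rfl)).resolve_right fun h => hgi (h.trans hg'i)
  refine (φ c).2.1 _ ?_ _ ?_ h.1
  · rw [hac, hea]
    exact ⟨fun _ => hgi.symm, fun _ => .inl rfl⟩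
  · have := hac (hG.thetaEquiv j)
    have := ha' (hG.thetaEquiv j)
    grind

/-! ### Degrees in the domain graph -/

omit [Finite E] in
/-- The degree of a vertex is the number of events that can be added to, or removed from, its
configuration. -/
theorem encard_neighborSet (hG : G.IsDomainGraph φ) (v : V) :
    (G.neighborSet v).encard = {e | 𝓔.IsConfiguration (symmDiff (φ v).1 {e})}.encard := by
  classical
  let g : E → V := fun e =>
    if h : 𝓔.IsConfiguration (symmDiff (φ v).1 {e}) then φ.symm ⟨_, h⟩ else v
  have hg : ∀ e, 𝓔.IsConfiguration (symmDiff (φ v).1 {e}) →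
      (φ (g e)).1 = symmDiff (φ v).1 {e} := by
    intro e he
    simp only [g, dif_pos he, φ.apply_symm_apply]
  have hinj : Set.InjOn g {e | 𝓔.IsConfiguration (symmDiff (φ v).1 {e})} := by
    intro e he f hf hef
    have := hg e he
    rw [hef, hg f hf] at this
    exact (Set.singleton_eq_singleton_iff.1 (symmDiff_right_injective _ this)).symm
  rw [← hinj.encard_image]
  congr 1
  ext w
  rw [mem_neighborSet, hG]
  constructor
  · rintro ⟨e, he⟩
    have hw : (φ w).1 = symmDiff (φ v).1 {e} := by rw [← he, symmDiff_symmDiff_cancel_left]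
    have hconf : 𝓔.IsConfiguration (symmDiff (φ v).1 {e}) := hw ▸ (φ w).2
    exact ⟨e, hconf, φ.injective (Subtype.ext ((hg e hconf).trans hw.symm))⟩
  · rintro ⟨e, he, rfl⟩
    exact ⟨e, by rw [hg e he, symmDiff_symmDiff_cancel_left]⟩

/-- The out-degree of a vertex is the number of events that can be added to its configuration. -/
theorem encard_pointedArc (hG : G.IsDomainGraph φ) (hα : (φ α).1 = ∅) (v : V) :
    {w | G.PointedArc α v w}.encard =
      {e | e ∉ (φ v).1 ∧ 𝓔.IsConfiguration (insert e (φ v).1)}.encard := by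
  classical
  let g : E → V := fun e =>
    if h : 𝓔.IsConfiguration (insert e (φ v).1) then φ.symm ⟨_, h⟩ else v
  have hg : ∀ e, 𝓔.IsConfiguration (insert e (φ v).1) → (φ (g e)).1 = insert e (φ v).1 := by
    intro e he
    simp only [g, dif_pos he, φ.apply_symm_apply]
  have hinj : Set.InjOn g {e | e ∉ (φ v).1 ∧ 𝓔.IsConfiguration (insert e (φ v).1)} := by
    intro e he f hf hef
    have := hg e he.2
    rw [hef, hg f hf.2] at this
    exact (Set.insert_inj he.1).1 this.symm
  rw [← hinj.encard_image]
  congr 1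
  ext w
  rw [Set.mem_ofPred_eq, hG.pointedArc_iff hα]
  constructor
  · rintro ⟨e, he, hw⟩
    have hconf : 𝓔.IsConfiguration (insert e (φ v).1) := hw ▸ (φ w).2
    exact ⟨e, ⟨he, hconf⟩, φ.injective (Subtype.ext ((hg e hconf).trans hw.symm))⟩
  · rintro ⟨e, he, rfl⟩
    exact ⟨e, he.1, hg e he.2⟩

end SimpleGraph.IsDomainGraph

namespace EventStructure

variable {E : Type*} {𝓔 : EventStructure E}

theorem pairwise_independent_enabled (C : Set E) :
    {e | e ∉ C ∧ 𝓔.IsConfiguration (insert e C)}.Pairwise 𝓔.Independent :=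
  fun _ he _ hf hne => independent_of_insert he.1 hf.1 hne he.2 hf.2

end EventStructure

/-! ### The event structure of a family of boxes -/

namespace BoxComplex

variable {m : ℕ} (B : Fin m → BoxIntegral.Box (Fin 3)) (L : Fin 3 → ℝ)

/-- The events of the lifted complex. A wall stands for crossing the plane of the subdivision with
the given equation upwards; the plane of equation `0` is not counted, since all vertices are beyond
it. The event of a box stands for moving along the corresponding axis of `ℝ^m`. -/
inductive Event : Type
  | wall (k : Fin 3) (x : ℝ) (hx : x ∈ cuts B L k) (h₀ : 0 < x)
  | box (i : Fin m)

variable {B L}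

/-- The causal order: the walls of one direction form a chain, and a box comes after the walls that
do not exceed its lower corner. -/
def Event.Le : Event B L → Event B L → Prop
  | .wall k x _ _, .wall k' x' _ _ => k = k' ∧ x ≤ x'
  | .wall k x _ _, .box i => x ≤ (B i).lower k
  | .box _, .wall _ _ _ _ => False
  | .box i, .box j => i = j

/-- The conflict relation: a box is in conflict with the walls that are beyond it, and with all
other boxes. -/
def Event.Conflict : Event B L → Event B L → Prop
  | .wall _ _ _ _, .wall _ _ _ _ => False
  | .wall k x _ _, .box i => (B i).upper k < x
  | .box i, .wall k x _ _ => (B i).upper k < x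
  | .box i, .box j => i ≠ j

theorem finite_cuts (k : Fin 3) : (cuts B L k).Finite :=
  ((Set.toFinite {0, L k}).union (Set.finite_range _)).union (Set.finite_range _)

instance : Finite (Event B L) := by
  have (k : Fin 3) : Finite (cuts B L k) := finite_cuts k
  let f : Event B L → (Σ k, cuts B L k) ⊕ Fin m
    | .wall k x hx _ => .inl ⟨k, x, hx⟩
    | .box i => .inr i
  refine Finite.of_injective f ?_
  rintro (⟨k, x, hx, h₀⟩ | i) (⟨k', x', hx', h₀'⟩ | j) h
  · simp only [f, Sum.inl.injEq, Sigma.mk.injEq] at h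
    obtain ⟨rfl, h⟩ := h
    obtain rfl : x = x' := congrArg Subtype.val (eq_of_heq h)
    rfl
  · simp [f] at h
  · simp [f] at h
  · simpa [f] using h

variable (B L) in
/-- The event structure of a family of boxes. -/
def eventStructure : EventStructure (Event B L) where
  le := Event.Le
  le_refl := by
    rintro (_ | _)
    · exact ⟨rfl, le_rfl⟩
    · rfl
  le_trans := by
    rintro (_ | _) (_ | _) (_ | _) h h'
    · exact ⟨h.1.trans h'.1, h.2.trans h'.2⟩
    · obtain ⟨rfl, h⟩ := h
      exact h.trans h'
    · exact h'.elim
    · obtain rfl : _ = _ := h'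
      exact h
    · exact h.elim
    · exact h.elim
    · exact h'.elim
    · exact Eq.trans h h'
  le_antisymm := by
    rintro (_ | _) (_ | _) h h'
    · obtain ⟨rfl, h⟩ := h
      obtain rfl := le_antisymm h h'.2
      rfl
    · exact h'.elim
    · exact h.elim
    · exact congrArg _ h
  conflict := Event.Conflict
  conflict_irrefl := by
    rintro (_ | _) h
    · exact h
    · exact h rfl
  conflict_symm := by
    rintro (_ | _) (_ | _) h
    · exact h
    · exact h
    · exact h
    · exact Ne.symm h
  conflict_hered := by
    rintro (_ | _) (_ | _) (_ | _) h h'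
    · exact h
    · exact h.elim
    · exact h'.elim
    · obtain rfl : _ = _ := h'
      exact h
    · obtain ⟨rfl, h'⟩ := h'
      exact lt_of_lt_of_le h h'
    · rintro rfl
      exact absurd ((BoxIntegral.Box.lower_lt_upper _ _).trans h) (not_lt.2 h')
    · exact h'.elim
    · obtain rfl : _ = _ := h'
      exact h
  finitary _ := Set.toFinite _

/-- Independent boxes meet: otherwise a wall separates them, and their conflict is not minimal. -/
theorem independent_box_iff (hB : ∀ i k, 0 < (B i).lower k) {i j : Fin m} :
    (eventStructure B L).Independent (.box i) (.box j) ↔ (intersectionGraph B).Adj i j := by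
  have key : ∀ i j : Fin m, (∃ e, e ≠ .box i ∧ (eventStructure B L).le e (.box i) ∧
      (eventStructure B L).conflict e (.box j)) ↔ ∃ k, (B j).upper k < (B i).lower k := by
    intro i j
    constructor
    · rintro ⟨⟨k, x, hx, h₀⟩ | i', h₁, h₂, h₃⟩
      · exact ⟨k, lt_of_lt_of_le h₃ h₂⟩
      · exact absurd (congrArg _ h₂) h₁
    · rintro ⟨k, hk⟩
      exact ⟨.wall k ((B i).lower k) (.inl (.inr ⟨i, rfl⟩)) (hB i k), by simp,
        le_refl ((B i).lower k), hk⟩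
  change _ ↔ i ≠ j ∧ _
  rw [BoxIntegral.Box.nonempty_inter_iff_meet]
  constructor
  · rintro (h | h)
    · have hij : ¬ i ≠ j := h.2.2
      exact absurd (not_not.1 hij) h.1
    · refine ⟨h.1, fun k => ⟨?_, ?_⟩⟩
      · by_contra! hlt
        obtain ⟨e, h₁, h₂, h₃⟩ := (key i j).2 ⟨k, hlt⟩
        exact h.2 ⟨e, h₁, fun h => (eventStructure B L).conflict_irrefl _ (h ▸ h₃),
          .inl ⟨h₂, h₃⟩⟩
      · by_contra! hlt
        obtain ⟨e, h₁, h₂, h₃⟩ := (key j i).2 ⟨k, hlt⟩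
        exact h.2 ⟨e, fun h => (eventStructure B L).conflict_irrefl _ (h ▸ h₃), h₁,
          .inr ⟨h₂, h₃⟩⟩
  · rintro ⟨hne, hm⟩
    refine .inr ⟨hne, ?_⟩
    rintro ⟨e, h₁, h₂, ⟨h₃, h₄⟩ | ⟨h₃, h₄⟩⟩
    · obtain ⟨k, hk⟩ := (key i j).1 ⟨e, h₁, h₃, h₄⟩
      exact absurd (hm k).1 (not_le.2 hk)
    · obtain ⟨k, hk⟩ := (key j i).1 ⟨e, h₂, h₃, h₄⟩
      exact absurd (hm k).2 (not_le.2 hk)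

/-! ### The vertices of the lifted complex -/

theorem cuts_nonneg (hB : ∀ i k, 0 < (B i).lower k) (hL : ∀ k, 0 < L k) {k : Fin 3} {x : ℝ}
    (hx : x ∈ cuts B L k) : 0 ≤ x := by
  rcases hx with ((rfl | rfl) | ⟨i, rfl⟩) | ⟨i, rfl⟩
  · exact le_rfl
  · exact (hL k).le
  · exact (hB i k).le
  · exact ((hB i k).trans ((B i).lower_lt_upper k)).le

theorem cuts_le (hL : ∀ k, 0 < L k) (hBL : ∀ i k, (B i).upper k ≤ L k) {k : Fin 3} {x : ℝ}
    (hx : x ∈ cuts B L k) : x ≤ L k := by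
  rcases hx with ((rfl | rfl) | ⟨i, rfl⟩) | ⟨i, rfl⟩
  · exact (hL k).le
  · exact le_rfl
  · exact ((B i).lower_lt_upper k).le.trans (hBL i k)
  · exact hBL i k

theorem zero_mem_cuts (k : Fin 3) : 0 ∈ cuts B L k := .inl (.inl (.inl rfl))

theorem length_mem_cuts (k : Fin 3) : L k ∈ cuts B L k := .inl (.inl (.inr rfl))

theorem lower_mem_cuts (i : Fin m) (k : Fin 3) : (B i).lower k ∈ cuts B L k := .inl (.inr ⟨i, rfl⟩)

theorem upper_mem_cuts (i : Fin m) (k : Fin 3) : (B i).upper k ∈ cuts B L k := .inr ⟨i, rfl⟩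

/-- Each element of a finite set of reals that is smaller than some other one has a successor. -/
theorem exists_succ {s : Set ℝ} (hs : s.Finite) {a b : ℝ} (hb : b ∈ s) (hab : a < b) :
    ∃ c ∈ s, a < c ∧ c ≤ b ∧ ∀ x ∈ s, ¬ (a < x ∧ x < c) := by
  obtain ⟨c, hc⟩ := (hs.inter_of_left (Set.Ioi a)).exists_minimal ⟨b, hb, hab⟩
  refine ⟨c, hc.prop.1, hc.prop.2, not_lt.1 fun h => ?_, fun x hx h => ?_⟩
  · exact absurd h (hc.not_lt ⟨hb, hab⟩)
  · exact absurd h.2 (hc.not_lt ⟨hx, h.1⟩)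

theorem exists_pred {s : Set ℝ} (hs : s.Finite) {a b : ℝ} (ha : a ∈ s) (hab : a < b) :
    ∃ c ∈ s, a ≤ c ∧ c < b ∧ ∀ x ∈ s, ¬ (c < x ∧ x < b) := by
  obtain ⟨c, hc⟩ := (hs.inter_of_left (Set.Iio b)).exists_maximal ⟨a, ha, hab⟩
  refine ⟨c, hc.prop.1, not_lt.1 fun h => ?_, hc.prop.2, fun x hx h => ?_⟩
  · exact absurd h (hc.not_gt ⟨ha, hab⟩)
  · exact absurd h.1 (hc.not_gt ⟨hx, h.2⟩)

/-- Two equal or consecutive elements of a finite set of reals are ends of an elementary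
interval, which can be taken inside any interval with ends in this set that contains them. -/
theorem exists_elementary_interval {s : Set ℝ} (hs : s.Finite) {a b p q : ℝ} (ha : a ∈ s)
    (hb : b ∈ s) (hab : a < b) (hp : p ∈ s) (hq : q ∈ s) (hp' : p ∈ Set.Icc a b)
    (hq' : q ∈ Set.Icc a b) (hpq : ∀ x ∈ s, ¬ (p < x ∧ x < q) ∧ ¬ (q < x ∧ x < p)) :
    ∃ lo hi, (lo ∈ s ∧ hi ∈ s ∧ lo < hi ∧ ∀ x ∈ s, ¬ (lo < x ∧ x < hi)) ∧ a ≤ lo ∧ hi ≤ b ∧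
      (p = lo ∨ p = hi) ∧ (q = lo ∨ q = hi) := by
  rcases lt_trichotomy p q with h | rfl | h
  · exact ⟨p, q, ⟨hp, hq, h, fun x hx => (hpq x hx).1⟩, hp'.1, hq'.2, .inl rfl, .inr rfl⟩
  · rcases hp'.2.lt_or_eq with h | rfl
    · obtain ⟨c, hc, h₁, h₂, h₃⟩ := exists_succ hs hb h
      exact ⟨p, c, ⟨hp, hc, h₁, h₃⟩, hp'.1, h₂, .inl rfl, .inl rfl⟩
    · obtain ⟨c, hc, h₁, h₂, h₃⟩ := exists_pred hs ha hab
      exact ⟨c, p, ⟨hc, hp, h₂, h₃⟩, h₁, le_rfl, .inr rfl, .inr rfl⟩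
  · exact ⟨q, p, ⟨hq, hp, h, fun x hx => (hpq x hx).2⟩, hq'.1, hp'.2, .inr rfl, .inl rfl⟩

/-- The grid points `p`, with the first `m` coordinates zero, or equal to those of the end of the
axis of a box that contains `p`. -/
def IsGridPoint (B : Fin m → BoxIntegral.Box (Fin 3)) (L : Fin 3 → ℝ) (q : Fin m ⊕ Fin 3 → ℝ) :
    Prop :=
  (∀ k, q (.inr k) ∈ cuts B L k) ∧ (∀ i, q (.inl i) = 0 ∨ q (.inl i) = 1) ∧
    ∀ i, q (.inl i) = 1 → (∀ j, q (.inl j) = 1 → j = i) ∧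
      ∀ k, q (.inr k) ∈ Set.Icc ((B i).lower k) ((B i).upper k)

theorem isGridPoint_of_isCorner {c : Cell (Fin m ⊕ Fin 3)} (hc : c ∈ liftedComplex B L)
    {q : Fin m ⊕ Fin 3 → ℝ} (hq : c.IsCorner q) : IsGridPoint B L q := by
  obtain ⟨c, hel, rfl | ⟨i, hsub, rfl⟩⟩ := hc
  · have hz : ∀ i, q (.inl i) = 0 := fun i => (hq (.inl i)).elim id id
    refine ⟨fun k => ?_, fun i => .inl (hz i), fun i hi => ?_⟩
    · rcases hq (.inr k) with h | h
      · exact h ▸ (hel k).1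
      · exact h ▸ (hel k).2.1
    · exact absurd ((hz i).symm.trans hi) zero_ne_one
  · have hz : ∀ j, j ≠ i → q (.inl j) = 0 := fun j hj => by
      have := hq (.inl j)
      simp only [liftCell, Sum.elim_inl, if_neg hj, or_self] at this
      exact this
    have hlt : ∀ k, c.lo k ≤ c.hi k := fun k => (hel k).2.2.1.le
    have hlo := hsub (Set.left_mem_Icc.2 hlt)
    have hhi := hsub (Set.right_mem_Icc.2 hlt)
    refine ⟨fun k => ?_, fun j => ?_, fun j hj => ?_⟩
    · rcases hq (.inr k) with h | h
      · exact h ▸ (hel k).1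
      · exact h ▸ (hel k).2.1
    · by_cases hji : j = i
      · have := hq (.inl j)
        simpa only [liftCell, Sum.elim_inl, if_pos hji] using this
      · exact .inl (hz j hji)
    · have heq : ∀ j, q (.inl j) = 1 → j = i := by
        intro j hj
        by_contra hji
        exact zero_ne_one ((hz j hji).symm.trans hj)
      obtain rfl := heq j hj
      refine ⟨heq, fun k => ?_⟩
      rcases hq (.inr k) with h | h
      · rw [h]
        exact ⟨hlo.1 k, hlo.2 k⟩
      · rw [h]
        exact ⟨hhi.1 k, hhi.2 k⟩

/-- Two grid points with equal or consecutive coordinates, whose first `m` coordinates vanish except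
possibly those of one box that contains both points, are corners of a common cell. -/
theorem exists_common_cell (hB : ∀ i k, 0 < (B i).lower k) (hL : ∀ k, 0 < L k)
    (hBL : ∀ i k, (B i).upper k ≤ L k) {p q : Fin m ⊕ Fin 3 → ℝ} (hp : IsGridPoint B L p)
    (hq : IsGridPoint B L q) (hpq : ∀ i j, p (.inl i) = 1 → q (.inl j) = 1 → i = j)
    (hmem : ∀ i, p (.inl i) = 1 ∨ q (.inl i) = 1 → ∀ k,
      p (.inr k) ∈ Set.Icc ((B i).lower k) ((B i).upper k) ∧
      q (.inr k) ∈ Set.Icc ((B i).lower k) ((B i).upper k))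
    (hcons : ∀ k, ∀ x ∈ cuts B L k, ¬ (p (.inr k) < x ∧ x < q (.inr k)) ∧
      ¬ (q (.inr k) < x ∧ x < p (.inr k))) :
    ∃ c ∈ liftedComplex B L, c.IsCorner p ∧ c.IsCorner q := by
  by_cases h : ∃ i, p (.inl i) = 1 ∨ q (.inl i) = 1
  · obtain ⟨i, hi⟩ := h
    have hz : ∀ j, j ≠ i → p (.inl j) = 0 ∧ q (.inl j) = 0 := by
      intro j hj
      refine ⟨(hp.2.1 j).resolve_right fun h => hj ?_, (hq.2.1 j).resolve_right fun h => hj ?_⟩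
      · rcases hi with hi | hi
        · exact (hp.2.2 i hi).1 j h
        · exact hpq j i h hi
      · rcases hi with hi | hi
        · exact (hpq i j hi h).symm
        · exact (hq.2.2 i hi).1 j h
    choose lo hi' hel hlo hhi hpc hqc using fun k =>
      exists_elementary_interval (finite_cuts k) (lower_mem_cuts i k) (upper_mem_cuts i k)
        ((B i).lower_lt_upper k) (hp.1 k) (hq.1 k) (hmem i hi k).1 (hmem i hi k).2 (hcons k)
    refine ⟨liftCell i ⟨lo, hi'⟩, ⟨⟨lo, hi'⟩, hel, .inr ⟨i, Set.Icc_subset_Icc hlo hhi, rfl⟩⟩,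
      ?_, ?_⟩
    · rintro (j | k)
      · by_cases hj : j = i
        · simpa only [liftCell, Sum.elim_inl, if_pos hj] using hp.2.1 j
        · exact .inl (hz j hj).1
      · exact hpc k
    · rintro (j | k)
      · by_cases hj : j = i
        · simpa only [liftCell, Sum.elim_inl, if_pos hj] using hq.2.1 j
        · exact .inl (hz j hj).2
      · exact hqc k
  · push Not at h
    choose lo hi hel hlo hhi hpc hqc using fun k =>
      exists_elementary_interval (finite_cuts k) (zero_mem_cuts k) (length_mem_cuts k) (hL k)
        (hp.1 k) (hq.1 k) ⟨cuts_nonneg hB hL (hp.1 k), cuts_le hL hBL (hp.1 k)⟩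
        ⟨cuts_nonneg hB hL (hq.1 k), cuts_le hL hBL (hq.1 k)⟩ (hcons k)
    refine ⟨embed ⟨lo, hi⟩, ⟨⟨lo, hi⟩, hel, .inl rfl⟩, ?_, ?_⟩
    · rintro (j | k)
      · exact .inl ((hp.2.1 j).resolve_right (h j).1)
      · exact hpc k
    · rintro (j | k)
      · exact .inl ((hq.2.1 j).resolve_right (h j).2)
      · exact hqc k

theorem isGridPoint_iff (hB : ∀ i k, 0 < (B i).lower k) (hL : ∀ k, 0 < L k)
    (hBL : ∀ i k, (B i).upper k ≤ L k) {q : Fin m ⊕ Fin 3 → ℝ} :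
    (∃ c ∈ liftedComplex B L, c.IsCorner q) ↔ IsGridPoint B L q := by
  constructor
  · rintro ⟨c, hc, hq⟩
    exact isGridPoint_of_isCorner hc hq
  · intro hq
    obtain ⟨c, hc, h, -⟩ := exists_common_cell hB hL hBL hq hq
      (fun i j hi hj => (hq.2.2 j hj).1 i hi)
      (fun i hi k => ⟨(hq.2.2 i (hi.elim id id)).2 k, (hq.2.2 i (hi.elim id id)).2 k⟩)
      fun k x _ => ⟨fun h => lt_asymm h.1 h.2, fun h => lt_asymm h.1 h.2⟩
    exact ⟨c, hc, h⟩

/-! ### The lifted graph as the graph of a domain -/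

/-- The configuration of a point: the walls it has crossed, and the box along the axis of which it
has moved. -/
def config (B : Fin m → BoxIntegral.Box (Fin 3)) (L : Fin 3 → ℝ) (q : Fin m ⊕ Fin 3 → ℝ) :
    Set (Event B L)
  | .wall k x _ _ => x ≤ q (.inr k)
  | .box i => q (.inl i) = 1

theorem wall_mem_config {q : Fin m ⊕ Fin 3 → ℝ} {k x hx h₀} :
    Event.wall k x hx h₀ ∈ config B L q ↔ x ≤ q (.inr k) := Iff.rfl

theorem box_mem_config {q : Fin m ⊕ Fin 3 → ℝ} {i} :
    Event.box i ∈ config B L q ↔ q (.inl i) = 1 := Iff.rfl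

theorem isConfiguration_config {q : Fin m ⊕ Fin 3 → ℝ} (hq : IsGridPoint B L q) :
    (eventStructure B L).IsConfiguration (config B L q) := by
  constructor
  · rintro (⟨k, x, _, _⟩ | i) ha (⟨k', x', _, _⟩ | j) hb hab
    · exact hab
    · exact absurd ((hq.2.2 j hb).2 k).2 (not_le.2 (lt_of_lt_of_le hab ha))
    · exact absurd ((hq.2.2 i ha).2 k').2 (not_le.2 (lt_of_lt_of_le hab hb))
    · exact hab ((hq.2.2 j hb).1 i ha)
  · rintro (⟨k, x, _, _⟩ | i) ha (⟨k', x', _, _⟩ | j) hle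
    · obtain ⟨rfl, hle⟩ := hle
      exact le_trans hle ha
    · exact hle.elim
    · exact le_trans (α := ℝ) hle ((hq.2.2 i ha).2 k').1
    · obtain rfl : _ = _ := hle
      exact ha

/-- The coordinate of a grid point is determined by the walls it has crossed. -/
theorem coord_eq_of_wall_iff (hB : ∀ i k, 0 < (B i).lower k) (hL : ∀ k, 0 < L k)
    {p q : Fin m ⊕ Fin 3 → ℝ} (hp : IsGridPoint B L p) (hq : IsGridPoint B L q) {k : Fin 3}
    (h : ∀ x ∈ cuts B L k, 0 < x → (x ≤ p (.inr k) ↔ x ≤ q (.inr k))) :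
    p (.inr k) = q (.inr k) := by
  have hp₀ := cuts_nonneg hB hL (hp.1 k)
  have hq₀ := cuts_nonneg hB hL (hq.1 k)
  rcases lt_trichotomy (p (.inr k)) (q (.inr k)) with hlt | heq | hlt
  · exact absurd ((h _ (hq.1 k) (hp₀.trans_lt hlt)).2 le_rfl) (not_le.2 hlt)
  · exact heq
  · exact absurd ((h _ (hp.1 k) (hq₀.trans_lt hlt)).1 le_rfl) (not_le.2 hlt)

theorem coord_eq_of_box_iff {p q : Fin m ⊕ Fin 3 → ℝ} (hp : IsGridPoint B L p)
    (hq : IsGridPoint B L q) {i : Fin m} (h : p (.inl i) = 1 ↔ q (.inl i) = 1) :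
    p (.inl i) = q (.inl i) := by
  rcases hp.2.1 i with h₁ | h₁ <;> rcases hq.2.1 i with h₂ | h₂ <;> simp_all

/-- The grid point of a configuration has as coordinates the largest walls of the configuration. -/
theorem exists_config_eq (hB : ∀ i k, 0 < (B i).lower k) {C : Set (Event B L)}
    (hC : (eventStructure B L).IsConfiguration C) :
    ∃ q, IsGridPoint B L q ∧ config B L q = C := by
  classical
  have hmax : ∀ k, ∃ p, Maximal (· ∈ {x | x ∈ cuts B L k ∧
      (x = 0 ∨ ∃ hx h₀, Event.wall k x hx h₀ ∈ C)}) p := fun k =>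
    ((finite_cuts (B := B) (L := L) k).subset fun x hx => hx.1).exists_maximal
      ⟨0, zero_mem_cuts k, .inl rfl⟩
  choose p hp using hmax
  have hwall : ∀ k x hx h₀, Event.wall k x hx h₀ ∈ C ↔ x ≤ p k := by
    intro k x hx h₀
    constructor
    · intro h
      by_contra! hlt
      exact (hp k).not_gt ⟨hx, .inr ⟨hx, h₀, h⟩⟩ hlt
    · intro h
      obtain ⟨hpx, hp₀, hpC⟩ := (hp k).prop.2.resolve_left (h₀.trans_le h).ne'
      exact hC.2 _ hpC _ ⟨rfl, h⟩
  refine ⟨Sum.elim (fun i => if Event.box i ∈ C then 1 else 0) p, ⟨fun k => (hp k).prop.1,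
    fun i => ?_, fun i hi => ?_⟩, ?_⟩
  · by_cases h : Event.box i ∈ C <;> simp [h]
  · have hi' : Event.box i ∈ C := by simpa using hi
    refine ⟨fun j hj => ?_, fun k => ⟨?_, ?_⟩⟩
    · have hj' : Event.box j ∈ C := by simpa using hj
      by_contra hne
      exact hC.1 _ hj' _ hi' hne
    · refine (hwall k _ (lower_mem_cuts i k) (hB i k)).1 (hC.2 _ hi' _ ?_)
      exact le_refl ((B i).lower k)
    · by_contra! hlt
      have hp₀ : 0 < p k := ((hB i k).trans ((B i).lower_lt_upper k)).trans hlt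
      exact hC.1 _ hi' _ ((hwall k _ (hp k).prop.1 hp₀).2 le_rfl) hlt
  · ext e
    rcases e with ⟨k, x, hx, h₀⟩ | i
    · exact (hwall k x hx h₀).symm
    · rw [box_mem_config]
      simp

section Equiv

variable (hB : ∀ i k, 0 < (B i).lower k) (hL : ∀ k, 0 < L k) (hBL : ∀ i k, (B i).upper k ≤ L k)

/-- The vertices of the lifted complex are the configurations of the event structure. -/
noncomputable def vertexEquiv : Vertex (liftedComplex B L) ≃ (eventStructure B L).Domain :=
  Equiv.ofBijective (fun v => ⟨config B L v.1,
    isConfiguration_config ((isGridPoint_iff hB hL hBL).1 v.2)⟩) <| by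
    constructor
    · rintro ⟨p, hp⟩ ⟨q, hq⟩ h
      rw [isGridPoint_iff hB hL hBL] at hp hq
      have h' := Set.ext_iff.1 (congrArg Subtype.val h)
      refine Subtype.ext (funext ?_)
      rintro (i | k)
      · exact coord_eq_of_box_iff hp hq (h' (.box i))
      · exact coord_eq_of_wall_iff hB hL hp hq fun x hx h₀ => h' (.wall k x hx h₀)
    · rintro ⟨C, hC⟩
      obtain ⟨q, hq, h⟩ := exists_config_eq hB hC
      exact ⟨⟨q, (isGridPoint_iff hB hL hBL).2 hq⟩, Subtype.ext h⟩

theorem isDomainGraph : (liftedGraph B L).IsDomainGraph (vertexEquiv hB hL hBL) := by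
  rintro ⟨p, hp⟩ ⟨q, hq⟩
  have hp' := (isGridPoint_iff hB hL hBL).1 hp
  have hq' := (isGridPoint_iff hB hL hBL).1 hq
  change ((∃ c ∈ liftedComplex B L, c.IsCorner p ∧ c.IsCorner q) ∧ ∃! κ, p κ ≠ q κ) ↔
    ∃ e, symmDiff (config B L p) (config B L q) = {e}
  constructor
  · rintro ⟨⟨c, hc, hcp, hcq⟩, κ, hκ, huniq⟩
    replace huniq : ∀ κ', κ' ≠ κ → p κ' = q κ' := fun κ' h => by
      by_contra hne
      exact h (huniq κ' hne)
    rcases κ with i | k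
    · refine ⟨.box i, Set.ext ?_⟩
      rintro (⟨k, x, hx, h₀⟩ | j)
      · simp only [Set.mem_symmDiff, wall_mem_config, huniq (.inr k) (by simp),
          Set.mem_singleton_iff, reduceCtorEq, iff_false]
        tauto
      · simp only [Set.mem_symmDiff, box_mem_config, Set.mem_singleton_iff, Event.box.injEq]
        by_cases hj : j = i
        · subst hj
          rcases hp'.2.1 j with h₁ | h₁ <;> rcases hq'.2.1 j with h₂ | h₂ <;> simp_all
        · rw [huniq (.inl j) (by simpa using hj)]
          tauto
    · obtain ⟨lo, hi, hlo, hhi, hlt, hcons, h⟩ : ∃ lo hi, lo ∈ cuts B L k ∧ hi ∈ cuts B L k ∧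
          lo < hi ∧ (∀ x ∈ cuts B L k, ¬ (lo < x ∧ x < hi)) ∧
          ((p (.inr k) = lo ∧ q (.inr k) = hi) ∨ (p (.inr k) = hi ∧ q (.inr k) = lo)) := by
        obtain ⟨c, hel, h⟩ := hc
        obtain ⟨h₁, h₂, h₃, h₄⟩ := hel k
        refine ⟨c.lo k, c.hi k, h₁, h₂, h₃, h₄, ?_⟩
        have hp₁ := hcp (.inr k)
        have hq₁ := hcq (.inr k)
        rcases h with rfl | ⟨i, -, rfl⟩ <;>
          simp only [embed, liftCell, Sum.elim_inr] at hp₁ hq₁ <;> grind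
      refine ⟨.wall k hi hhi ((cuts_nonneg hB hL hlo).trans_lt hlt), Set.ext ?_⟩
      rintro (⟨k', x, hx, h₀⟩ | j)
      · simp only [Set.mem_symmDiff, wall_mem_config, Set.mem_singleton_iff, Event.wall.injEq]
        by_cases hk : k' = k
        · subst hk
          have := hcons x hx
          have hx' : (lo < x ∧ x ≤ hi) ↔ x = hi := by grind
          rcases h with ⟨h₁, h₂⟩ | ⟨h₁, h₂⟩ <;> rw [h₁, h₂] <;> grind
        · rw [huniq (.inr k') (by simpa using hk)]
          tauto
      · simp only [Set.mem_symmDiff, box_mem_config, Set.mem_singleton_iff, reduceCtorEq, iff_false]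
        rw [huniq (.inl j) (by simp)]
        tauto
  · rintro ⟨e, he⟩
    have he' := Set.ext_iff.1 he
    have hiff : ∀ f, f ≠ e → (f ∈ config B L p ↔ f ∈ config B L q) := by
      intro f hf
      have := he' f
      simp only [Set.mem_symmDiff, Set.mem_singleton_iff] at this
      tauto
    have hdiff : ¬ (e ∈ config B L p ↔ e ∈ config B L q) := by
      have := he' e
      simp only [Set.mem_symmDiff, Set.mem_singleton_iff] at this
      tauto
    rcases e with ⟨k, x, hx, h₀⟩ | i
    · have hbox : ∀ j, p (.inl j) = q (.inl j) := fun j =>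
        coord_eq_of_box_iff hp' hq' (hiff (.box j) (by simp))
      have hcoord : ∀ k', k' ≠ k → p (.inr k') = q (.inr k') := fun k' hk' =>
        coord_eq_of_wall_iff hB hL hp' hq' fun x' hx' h₀' =>
          hiff (.wall k' x' hx' h₀') (by simp [hk'])
      have hne : p (.inr k) ≠ q (.inr k) := fun h => hdiff (by
        rw [wall_mem_config, wall_mem_config, h])
      have hp₀ := cuts_nonneg hB hL (hp'.1 k)
      have hq₀ := cuts_nonneg hB hL (hq'.1 k)
      -- two distinct walls crossed by only one of the points would both be the given event
      have hwall : ∀ y (hy : y ∈ cuts B L k), 0 < y → y ≠ x → (y ≤ p (.inr k) ↔ y ≤ q (.inr k)) :=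
        fun y hy h h' => hiff (.wall k y hy h) (by simpa using h')
      obtain ⟨c, hc, h₁, h₂⟩ := exists_common_cell hB hL hBL hp' hq'
        (fun i j hi hj => (hq'.2.2 j hj).1 i (hbox i ▸ hi))
        (fun i hi k' => by
          have hi₁ : p (.inl i) = 1 := hi.elim id fun h => (hbox i).trans h
          have hi₂ : q (.inl i) = 1 := (hbox i).symm.trans hi₁
          exact ⟨(hp'.2.2 i hi₁).2 k', (hq'.2.2 i hi₂).2 k'⟩)
        (fun k' y hy => by
          by_cases hk : k' = k
          · subst hk
            have hy' := hwall y hy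
            have hp₁ := hwall _ (hp'.1 k')
            have hq₁ := hwall _ (hq'.1 k')
            constructor
            · rintro ⟨h, h'⟩
              by_cases hyx : y = x
              · exact absurd ((hq₁ (by linarith) (by rw [← hyx]; exact h'.ne')).2 le_rfl)
                  (by linarith)
              · exact absurd ((hy' (by linarith) hyx).2 h'.le) (by linarith)
            · rintro ⟨h, h'⟩
              by_cases hyx : y = x
              · exact absurd ((hp₁ (by linarith) (by rw [← hyx]; exact h'.ne')).1 le_rfl)
                  (by linarith)
              · exact absurd ((hy' (by linarith) hyx).1 h'.le) (by linarith)
          · rw [hcoord k' hk]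
            exact ⟨fun h => lt_asymm h.1 h.2, fun h => lt_asymm h.1 h.2⟩)
      refine ⟨⟨c, hc, h₁, h₂⟩, .inr k, hne, ?_⟩
      rintro (j | k') h
      · exact absurd (hbox j) h
      · by_contra hk
        exact h (hcoord k' fun h => hk (congrArg _ h))
    · have hbox : ∀ j, j ≠ i → p (.inl j) = q (.inl j) := fun j hj =>
        coord_eq_of_box_iff hp' hq' (hiff (.box j) (by simpa using hj))
      have hcoord : ∀ k, p (.inr k) = q (.inr k) := fun k =>
        coord_eq_of_wall_iff hB hL hp' hq' fun x' hx' h₀' =>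
          hiff (.wall k x' hx' h₀') (by simp)
      have hne : p (.inl i) ≠ q (.inl i) := fun h => hdiff (by
        rw [box_mem_config, box_mem_config, h])
      have hone : ∀ j, p (.inl j) = 1 ∨ q (.inl j) = 1 → j = i := by
        intro j hj
        by_contra hji
        have heq := hbox j hji
        have h₁ := hp'.2.1 i
        have h₂ := hq'.2.1 i
        have h₃ := hp'.2.2 j
        have h₄ := hq'.2.2 j
        have hj₁ : p (.inl j) = 1 := hj.elim id fun h => heq.trans h
        have hj₂ : q (.inl j) = 1 := heq.symm.trans hj₁
        have h₅ : p (.inl i) ≠ 1 := fun h => hji ((h₃ hj₁).1 i h).symm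
        have h₆ : q (.inl i) ≠ 1 := fun h => hji ((h₄ hj₂).1 i h).symm
        exact hne ((h₁.resolve_right h₅).trans (h₂.resolve_right h₆).symm)
      obtain ⟨c, hc, h₁, h₂⟩ := exists_common_cell hB hL hBL hp' hq'
        (fun j j' hj hj' => (hone j (.inl hj)).trans (hone j' (.inr hj')).symm)
        (fun j hj k => by
          rw [← hcoord k, and_self]
          rcases hj with hj | hj
          · exact (hp'.2.2 j hj).2 k
          · rw [hcoord k]
            exact (hq'.2.2 j hj).2 k)
        (fun k y hy => by
          rw [hcoord k]
          exact ⟨fun h => lt_asymm h.1 h.2, fun h => lt_asymm h.1 h.2⟩)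
      refine ⟨⟨c, hc, h₁, h₂⟩, .inl i, hne, ?_⟩
      rintro (j | k) h
      · by_contra hj
        exact h (hbox j fun h => hj (congrArg _ h))
      · exact absurd (hcoord k) h

end Equiv

end BoxComplex

/-! ### Counting events -/

theorem SimpleGraph.CliqueFree.encard_le_two {V : Type*} {G : SimpleGraph V} (hG : G.CliqueFree 3)
    {s : Set V} (hs : s.Pairwise G.Adj) : s.encard ≤ 2 := by
  classical
  by_contra! h
  obtain ⟨t, hts, ht⟩ := Set.exists_subset_encard_eq (s := s) (k := 3)
    (le_of_eq_of_le (by norm_num) (Order.add_one_le_of_lt h))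
  obtain ⟨x, y, z, hxy, hxz, hyz, rfl⟩ := Set.encard_eq_three.1 ht
  exact hG {x, y, z} (SimpleGraph.is3Clique_iff.2 ⟨x, y, z, hs (hts (by simp)) (hts (by simp)) hxy,
    hs (hts (by simp)) (hts (by simp)) hxz, hs (hts (by simp)) (hts (by simp)) hyz, rfl⟩)

namespace EventStructure

variable {E : Type*} {𝓔 : EventStructure E}

theorem isConfiguration_insert {C : Set E} (hC : 𝓔.IsConfiguration C) {e : E}
    (hle : ∀ f, 𝓔.le f e → f ≠ e → f ∈ C) (hconf : ∀ f ∈ C, ¬ 𝓔.conflict e f) :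
    𝓔.IsConfiguration (insert e C) := by
  constructor
  · rintro a (rfl | ha) b (rfl | hb) hab
    · exact 𝓔.conflict_irrefl _ hab
    · exact hconf b hb hab
    · exact hconf a ha (𝓔.conflict_symm _ _ hab)
    · exact hC.1 a ha b hb hab
  · rintro a (rfl | ha) b hb
    · exact or_iff_not_imp_left.2 (hle b hb)
    · exact .inr (hC.2 a ha b hb)

/-- Two comparable events cannot both be added to a configuration, nor can they both be removed. -/
theorem eq_of_le_of_isConfiguration_symmDiff {C : Set E} {e f : E} (hle : 𝓔.le e f)
    (he : 𝓔.IsConfiguration (symmDiff C {e})) (hf : 𝓔.IsConfiguration (symmDiff C {f}))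
    (hmem : e ∈ C ↔ f ∈ C) : e = f := by
  by_contra hne
  by_cases heC : e ∈ C
  · have h := he.2 f (.inl ⟨hmem.1 heC, fun h => hne h.symm⟩) e hle
    exact h.elim (fun h => h.2 rfl) fun h => h.2 heC
  · have h := hf.2 f (.inr ⟨rfl, fun h => heC (hmem.2 h)⟩) e hle
    exact h.elim (fun h => heC h.1) fun h => hne h.1

end EventStructure

namespace BoxComplex

variable {m : ℕ} {B : Fin m → BoxIntegral.Box (Fin 3)} {L : Fin 3 → ℝ}

/-- The direction of a wall (with the value `0` at the events of the boxes). -/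
def Event.dir : Event B L → Fin 3
  | .wall k _ _ _ => k
  | .box _ => 0

/-- The size of a set of events with at most two boxes is bounded through the values of any function
that is injective on its walls. -/
theorem encard_le_card_add_two {s : Set (Event B L)} {γ : Type} [Fintype γ] (f : Event B L → γ)
    (hbox : {i | Event.box i ∈ s}.encard ≤ 2)
    (hf : ∀ k x hx h₀, Event.wall k x hx h₀ ∈ s → ∀ k' y hy h₀', Event.wall k' y hy h₀' ∈ s →
      f (.wall k x hx h₀) = f (.wall k' y hy h₀') → k = k' ∧ x = y) :
    s.encard ≤ Fintype.card γ + 2 := by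
  have hsub : s ⊆ {e ∈ s | ∃ k x hx h₀, e = .wall k x hx h₀} ∪
      Event.box '' {i | Event.box i ∈ s} := by
    rintro (⟨k, x, hx, h₀⟩ | i) h
    · exact .inl ⟨h, k, x, hx, h₀, rfl⟩
    · exact .inr ⟨i, h, rfl⟩
  refine (Set.encard_le_encard hsub).trans ((Set.encard_union_le _ _).trans ?_)
  gcongr
  · refine (Set.encard_le_encard_of_injOn (t := Set.univ) (f := f) (fun _ _ => trivial) ?_).trans ?_
    · rintro _ ⟨h, k, x, hx, h₀, rfl⟩ _ ⟨h', k', y, hy, h₀', rfl⟩ heq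
      obtain ⟨rfl, rfl⟩ := hf _ _ _ _ h _ _ _ _ h' heq
      rfl
    · rw [Set.encard_univ, ENat.card_eq_coe_fintype_card]
  · exact (Set.encard_image_le _ _).trans hbox

theorem le_total_wall (k : Fin 3) {x y : ℝ} (hx hy h₀ h₀') :
    (eventStructure B L).le (.wall k x hx h₀) (.wall k y hy h₀') ∨
      (eventStructure B L).le (.wall k y hy h₀') (.wall k x hx h₀) :=
  (le_total x y).imp (fun h => ⟨rfl, h⟩) fun h => ⟨rfl, h⟩

/-- An independent set has at most one wall in each direction and at most two boxes. -/
theorem encard_independent_le (hB : ∀ i k, 0 < (B i).lower k)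
    (hfree : (intersectionGraph B).CliqueFree 3) {s : Set (Event B L)}
    (hs : s.Pairwise (eventStructure B L).Independent) : s.encard ≤ 5 := by
  refine (encard_le_card_add_two Event.dir ?_ ?_).trans (by norm_num)
  · refine hfree.encard_le_two fun i hi j hj hij => (independent_box_iff hB).1 (hs hi hj ?_)
    simpa using hij
  · rintro k x hx h₀ h k' y hy h₀' h' (rfl : k = k')
    refine ⟨rfl, ?_⟩
    by_contra hne
    have hind := hs h h' (by simpa using hne)
    exact (le_total_wall k hx hy h₀ h₀').elim hind.not_le hind.symm.not_le

/-- In each direction at most one wall can be added to a configuration, and at most one removed. -/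
theorem encard_symmDiff_le (hB : ∀ i k, 0 < (B i).lower k)
    (hfree : (intersectionGraph B).CliqueFree 3) {C : Set (Event B L)}
    (hC : (eventStructure B L).IsConfiguration C) :
    {e | (eventStructure B L).IsConfiguration (symmDiff C {e})}.encard ≤ 8 := by
  classical
  refine (encard_le_card_add_two (fun e => (e.dir, decide (e ∈ C))) ?_ ?_).trans
    (by norm_num)
  · by_cases h : ∃ i, Event.box i ∈ C
    · obtain ⟨i, hi⟩ := h
      have hsub : {j | Event.box j ∈ {e | (eventStructure B L).IsConfiguration (symmDiff C {e})}} ⊆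
          {i} := by
        intro j hj
        by_contra hji
        have hjC : Event.box j ∉ C := fun h => hC.1 _ h _ hi hji
        refine hj.1 (.box j) (.inr ⟨rfl, hjC⟩) (.box i) (.inl ⟨hi, ?_⟩) hji
        rintro ⟨⟩
        exact hji rfl
      refine (Set.encard_le_encard hsub).trans ?_
      rw [Set.encard_singleton]
      exact one_le_two
    · push Not at h
      refine hfree.encard_le_two fun i hi j hj hij => (independent_box_iff hB).1
        (EventStructure.independent_of_insert (h i) (h j) (by simpa using hij) ?_ ?_)
      · exact Set.symmDiff_singleton_of_notMem (h i) ▸ hi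
      · exact Set.symmDiff_singleton_of_notMem (h j) ▸ hj
  · intro k x hx h₀ h k' y hy h₀' h' heq
    obtain ⟨rfl, hmem⟩ := Prod.ext_iff.1 heq
    replace hmem := decide_eq_decide.1 hmem
    have key : Event.wall k x hx h₀ = .wall k y hy h₀' :=
      (le_total_wall k hx hy h₀ h₀').elim
        (fun hle => EventStructure.eq_of_le_of_isConfiguration_symmDiff hle h h' hmem)
        fun hle => (EventStructure.eq_of_le_of_isConfiguration_symmDiff hle h' h hmem.symm).symm
    exact ⟨rfl, (Event.wall.inj key).2⟩

/-- At the smallest common point of two boxes that meet, five events can be added: one wall in each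
direction, and the two boxes; moreover one wall in each direction can be removed. -/
theorem exists_gridPoint_of_adj (hB : ∀ i k, 0 < (B i).lower k)
    (hBL : ∀ i k, (B i).upper k ≤ L k) {i j : Fin m} (hij : (intersectionGraph B).Adj i j) :
    ∃ q, IsGridPoint B L q ∧
      5 ≤ {e | e ∉ config B L q ∧
        (eventStructure B L).IsConfiguration (insert e (config B L q))}.encard ∧
      8 ≤ {e | (eventStructure B L).IsConfiguration (symmDiff (config B L q) {e})}.encard := by
  have hne := hij.ne
  have hm := BoxIntegral.Box.nonempty_inter_iff_meet.1 hij.2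
  let p : Fin 3 → ℝ := fun k => max ((B i).lower k) ((B j).lower k)
  have hp : ∀ k, p k ∈ cuts B L k := fun k => by
    rcases max_choice ((B i).lower k) ((B j).lower k) with h | h
    · rw [show p k = _ from h]
      exact lower_mem_cuts i k
    · rw [show p k = _ from h]
      exact lower_mem_cuts j k
  have hp₀ : ∀ k, 0 < p k := fun k => lt_max_of_lt_left (hB i k)
  have hpL : ∀ k, p k < L k := fun k =>
    max_lt (((B i).lower_lt_upper k).trans_le (hBL i k))
      (((B j).lower_lt_upper k).trans_le (hBL j k))
  have hpi : ∀ k, p k ≤ (B i).upper k := fun k => max_le ((B i).lower_lt_upper k).le (hm k).2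
  have hpj : ∀ k, p k ≤ (B j).upper k := fun k => max_le (hm k).1 ((B j).lower_lt_upper k).le
  choose t ht hpt _ hcons using fun k =>
    exists_succ (finite_cuts (B := B) (L := L) k) (length_mem_cuts k) (hpL k)
  let q : Fin m ⊕ Fin 3 → ℝ := Sum.elim (fun _ => 0) p
  have hq : IsGridPoint B L q :=
    ⟨hp, fun _ => .inl rfl, fun _ h => absurd h zero_ne_one⟩
  have hC := isConfiguration_config hq
  have hbox : ∀ b, Event.box b ∉ config B L q := fun b h => zero_ne_one h
  have hout_wall : ∀ k, Event.wall k (t k) (ht k) ((hp₀ k).trans (hpt k)) ∉ config B L q ∧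
      (eventStructure B L).IsConfiguration
        (insert (.wall k (t k) (ht k) ((hp₀ k).trans (hpt k))) (config B L q)) := by
    intro k
    refine ⟨not_le.2 (hpt k), EventStructure.isConfiguration_insert hC ?_ ?_⟩
    · rintro (⟨k', x, hx, h₀⟩ | b) hle hne
      · obtain ⟨rfl, hle⟩ := hle
        have hlt : x < t k' := lt_of_le_of_ne hle fun h => hne (by subst h; rfl)
        exact not_lt.1 fun h => hcons k' x hx ⟨h, hlt⟩
      · exact hle.elim
    · rintro (⟨k', x, hx, h₀⟩ | b) hmem
      · exact id
      · exact absurd hmem (hbox b)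
  have hout_box : ∀ b, (∀ k, (B b).lower k ≤ p k) → (∀ k, p k ≤ (B b).upper k) →
      Event.box b ∉ config B L q ∧
      (eventStructure B L).IsConfiguration (insert (.box b) (config B L q)) := by
    intro b hlo hhi
    refine ⟨hbox b, EventStructure.isConfiguration_insert hC ?_ ?_⟩
    · rintro (⟨k, x, hx, h₀⟩ | b') hle hne
      · exact le_trans (α := ℝ) hle (hlo k)
      · exact absurd (congrArg _ hle) hne
    · rintro (⟨k, x, hx, h₀⟩ | b') hmem hc
      · exact absurd (lt_of_lt_of_le hc hmem) (not_lt.2 (hhi k))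
      · exact hbox b' hmem
  have hin : ∀ k, (eventStructure B L).IsConfiguration
      (symmDiff (config B L q) {.wall k (p k) (hp k) (hp₀ k)}) := by
    intro k
    have hmem : Event.wall k (p k) (hp k) (hp₀ k) ∈ config B L q := le_refl (p k)
    rw [Set.symmDiff_singleton_of_mem hmem]
    refine ⟨fun a ha b hb => hC.1 a ha.1 b hb.1, fun a ha b hle => ⟨hC.2 a ha.1 b hle, ?_⟩⟩
    rintro rfl
    rcases a with ⟨k', x, hx, h₀⟩ | b
    · obtain ⟨rfl, hle⟩ := hle
      have hx' : x = p k := le_antisymm ha.1 hle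
      exact ha.2 (by subst hx'; rfl)
    · exact hbox b ha.1
  have hpt' : ∀ k, p k ≠ t k := fun k => (hpt k).ne
  have hbs : ∀ b : Bool, Event.box (bif b then i else j) ∉ config B L q ∧
      (eventStructure B L).IsConfiguration
        (insert (.box (bif b then i else j)) (config B L q)) := by
    rintro (_ | _)
    · exact hout_box j (fun k => le_max_right _ _) hpj
    · exact hout_box i (fun k => le_max_left _ _) hpi
  have hbinj : ∀ b b' : Bool, (bif b then i else j) = (bif b' then i else j) → b = b' := by
    rintro (_ | _) (_ | _) h
    · rfl
    · exact absurd h.symm hne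
    · exact absurd h hne
    · rfl
  refine ⟨q, hq, ?_, ?_⟩
  · let g : Fin 3 ⊕ Bool → Event B L :=
      Sum.elim (fun k => .wall k (t k) (ht k) ((hp₀ k).trans (hpt k)))
        fun b => .box (bif b then i else j)
    have hg : Function.Injective g := by
      rintro (k | b) (k' | b') h
      · exact congrArg _ (Event.wall.inj h).1
      · cases h
      · cases h
      · exact congrArg _ (hbinj _ _ (Event.box.inj h))
    have hrange : (Set.range g).encard = 5 := by
      rw [← Set.image_univ, hg.encard_image, Set.encard_univ]
      simp
    rw [← hrange]
    refine Set.encard_le_encard ?_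
    rintro _ ⟨k | b, rfl⟩
    · exact hout_wall k
    · exact hbs b
  · let g : (Fin 3 ⊕ Fin 3) ⊕ Bool → Event B L :=
      Sum.elim (Sum.elim (fun k => .wall k (t k) (ht k) ((hp₀ k).trans (hpt k)))
        fun k => .wall k (p k) (hp k) (hp₀ k)) fun b => .box (bif b then i else j)
    have hg : Function.Injective g := by
      rintro ((k | k) | b) ((k' | k') | b') h
      · exact congrArg _ (congrArg _ (Event.wall.inj h).1)
      · obtain ⟨rfl, h⟩ := Event.wall.inj h
        exact absurd h.symm (hpt' k)
      · cases h
      · obtain ⟨rfl, h⟩ := Event.wall.inj h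
        exact absurd h (hpt' k)
      · exact congrArg _ (congrArg _ (Event.wall.inj h).1)
      · cases h
      · cases h
      · cases h
      · exact congrArg _ (hbinj _ _ (Event.box.inj h))
    have hrange : (Set.range g).encard = 8 := by
      rw [← Set.image_univ, hg.encard_image, Set.encard_univ]
      simp
    rw [← hrange]
    refine Set.encard_le_encard ?_
    rintro _ ⟨(k | k) | b, rfl⟩
    · have := hout_wall k
      rw [← Set.symmDiff_singleton_of_notMem this.1] at this
      exact this.2
    · exact hin k
    · have := hbs b
      rw [← Set.symmDiff_singleton_of_notMem this.1] at this
      exact this.2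

end BoxComplex

/-! ### The family of boxes of the Burling graph -/

open GraphWithSets BoxComplex

theorem exists_boxes_burling (n : ℕ) : ∃ (m : ℕ) (B : Fin m → BoxIntegral.Box (Fin 3)),
    (∀ i k, 0 < (B i).lower k) ∧ Nonempty (intersectionGraph B ≃g (burling n).graph) := by
  obtain ⟨R⟩ := BoxRepresentation.nonempty_burling n
    ⟨fun _ => 0, fun _ => 1, fun _ => zero_lt_one⟩
  have := (finite_burling n).1
  obtain ⟨m, ⟨e⟩⟩ := Finite.exists_equiv_fin (burling n).V
  refine ⟨m, fun i => R.box (e.symm i), fun i k => (R.box_inside _ k).1, ⟨⟨e.symm, ?_⟩⟩⟩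
  intro i j
  change _ ↔ i ≠ j ∧ _
  rw [BoxIntegral.Box.nonempty_inter_iff_meet]
  constructor
  · intro h
    have hne := h.ne
    exact ⟨fun hij => hne (congrArg _ hij), (R.adj_iff _ _ hne).1 h⟩
  · rintro ⟨hne, h⟩
    exact (R.adj_iff _ _ (e.symm.injective.ne hne)).2 h

theorem SimpleGraph.CliqueFree.cliqueNum_eq_two {V : Type*} [Finite V] {G : SimpleGraph V}
    (hG : G.CliqueFree 3) {u v : V} (huv : G.Adj u v) : G.cliqueNum = 2 := by
  classical
  apply le_antisymm
  · obtain ⟨s, hs⟩ := G.exists_isNClique_cliqueNum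
    by_contra! h
    exact hG.mono (by omega) s hs
  · have h : G.IsClique (({u, v} : Finset V) : Set V) := by
      simp [SimpleGraph.isClique_iff, huv]
    have := h.card_le_cliqueNum
    rwa [Finset.card_pair huv.ne] at this

/-- A labelling in which adjacent vertices have different labels uses more labels than `n`, if the
chromatic number is more than `n`. -/
theorem SimpleGraph.lt_encard_range {V A : Type*} {G : SimpleGraph V} {n : ℕ}
    (hG : (n : ℕ∞) < G.chromaticNumber) (f : V → A) (hf : ∀ u v, G.Adj u v → f u ≠ f v)
    {s : Set A} (hs : ∀ v, f v ∈ s) : (n : ℕ∞) < s.encard := by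
  by_contra! h
  have := (Set.finite_of_encard_le_coe h).fintype
  have hcol : G.Colorable (Fintype.card s) :=
    (SimpleGraph.Coloring.mk (fun v => (⟨f v, hs v⟩ : s)) fun {u v} huv heq =>
      hf u v huv (congrArg Subtype.val heq)).colorable
  have hle := SimpleGraph.chromaticNumber_le_iff_colorable.2 hcol
  rw [← Set.toFinset_card, ← Set.encard_eq_coe_toFinset_card] at hle
  exact absurd (hle.trans h) (not_le.2 hG)

theorem mainTheorem2 (n : ℕ) (hn : 0 < n) :
    -- the family `B(n)` of boxes in the open first octant, with Burling's intersection graph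
    ∃ (m : ℕ) (B : Fin m → BoxIntegral.Box (Fin 3)),
      (∀ i k, 0 < (B i).lower k) ∧
      Nonempty (intersectionGraph B ≃g (GraphWithSets.burling n).graph) ∧
      (intersectionGraph B).cliqueNum = 2 ∧
      (n : ℕ∞) < (intersectionGraph B).chromaticNumber ∧
      -- any box `B₀ = [0, L 0] × [0, L 1] × [0, L 2]` containing the family
      ∀ L : Fin 3 → ℝ, (∀ i k, (B i).upper k ≤ L k) →
        -- the lifted graph
        Finite (BoxComplex.Vertex (BoxComplex.liftedComplex B L)) ∧
        (BoxComplex.liftedGraph B L).IsMedian ∧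
        IsGreatest (Set.range fun v => ((BoxComplex.liftedGraph B L).neighborSet v).encard) 8 ∧
        (n : ℕ∞) < (BoxComplex.liftedGraph B L).contactGraph.chromaticNumber ∧
        -- the lifted graph pointed at the origin
        ∃ α : BoxComplex.Vertex (BoxComplex.liftedComplex B L), α.1 = 0 ∧
          IsGreatest
            (Set.range fun v => {w | (BoxComplex.liftedGraph B L).PointedArc α v w}.encard) 5 ∧
          (n : ℕ∞) < ((BoxComplex.liftedGraph B L).pointedContactGraph α).chromaticNumber ∧
          -- the associated event structure
          ∃ 𝓔 : EventStructure (BoxComplex.liftedGraph B L).ThetaClass,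
            𝓔.IsAssociated (BoxComplex.liftedGraph B L) α ∧
            Finite (BoxComplex.liftedGraph B L).ThetaClass ∧
            Nonempty (((· ⋖ ·) : 𝓔.Domain → 𝓔.Domain → Prop) ≃r
              (BoxComplex.liftedGraph B L).PointedArc α) ∧
            𝓔.degree = 5 ∧
            ∀ (A : Type*) (lab : (BoxComplex.liftedGraph B L).ThetaClass → A),
              𝓔.IsNiceLabeling lab → (n : ℕ∞) < (Set.range lab).encard := by
  obtain ⟨m, B, hB, ⟨ψ⟩⟩ := exists_boxes_burling n
  have hfree : (intersectionGraph B).CliqueFree 3 :=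
    (cliqueFree_burling n).comap ψ.isContained
  have hchrom : (n : ℕ∞) < (intersectionGraph B).chromaticNumber :=
    (lt_chromaticNumber_burling n).trans_le
      (SimpleGraph.chromaticNumber_mono_of_hom ψ.symm.toHom)
  obtain ⟨u, w, huw⟩ := exists_adj_burling hn
  obtain ⟨i, j, hij⟩ : ∃ i j, (intersectionGraph B).Adj i j :=
    ⟨_, _, ψ.symm.map_adj_iff.2 huw⟩
  refine ⟨m, B, hB, ⟨ψ⟩, hfree.cliqueNum_eq_two hij, hchrom, fun L hBL => ?_⟩
  have hL : ∀ k, 0 < L k := fun k =>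
    ((hB i k).trans ((B i).lower_lt_upper k)).trans_le (hBL i k)
  have hG := isDomainGraph hB hL hBL
  have hα₀ : IsGridPoint B L 0 :=
    ⟨fun k => zero_mem_cuts k, fun _ => .inl rfl, fun _ h => absurd h zero_ne_one⟩
  let α : Vertex (liftedComplex B L) := ⟨0, (isGridPoint_iff hB hL hBL).2 hα₀⟩
  have hα : (vertexEquiv hB hL hBL α).1 = ∅ := by
    rw [Set.eq_empty_iff_forall_notMem]
    rintro (⟨k, x, hx, h₀⟩ | b) h
    · exact absurd h (not_le.2 h₀)
    · exact zero_ne_one h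
  obtain ⟨q, hq, hq₅, hq₈⟩ := exists_gridPoint_of_adj hB hBL hij
  let v : Vertex (liftedComplex B L) := ⟨q, (isGridPoint_iff hB hL hBL).2 hq⟩
  have hindep : ∀ s : Set (Event B L), s.Pairwise (eventStructure B L).Independent →
      s.encard ≤ 5 := fun s => encard_independent_le hB hfree
  let θ := hG.thetaEquiv
  -- the classes of two boxes that meet are those of independent events
  have hadj : ∀ b b', (intersectionGraph B).Adj b b' →
      (eventStructure B L).Independent (θ (θ.symm (.box b))) (θ (θ.symm (.box b'))) := by
    intro b b' h
    rw [θ.apply_symm_apply, θ.apply_symm_apply]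
    exact (independent_box_iff hB).2 h
  refine ⟨?_, hG.isMedian, ⟨⟨v, ?_⟩, ?_⟩, ?_, α, rfl, ⟨⟨v, ?_⟩, ?_⟩, ?_,
    (eventStructure B L).comap θ, hG.isAssociated hα, Finite.of_equiv _ θ.symm,
    hG.nonempty_covBy_relIso hα, ?_, ?_⟩
  · exact Finite.of_equiv _ (vertexEquiv hB hL hBL).symm
  · change ((liftedGraph B L).neighborSet v).encard = 8
    rw [hG.encard_neighborSet]
    exact le_antisymm (encard_symmDiff_le hB hfree (Subtype.prop _)) hq₈
  · rintro _ ⟨v, rfl⟩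
    change ((liftedGraph B L).neighborSet v).encard ≤ 8
    rw [hG.encard_neighborSet]
    exact encard_symmDiff_le hB hfree (Subtype.prop _)
  · exact hchrom.trans_le (SimpleGraph.chromaticNumber_mono_of_hom
      ⟨fun b => θ.symm (.box b), fun h => hG.contactGraph_adj hα (hadj _ _ h)⟩)
  · change {w | (liftedGraph B L).PointedArc α v w}.encard = 5
    rw [hG.encard_pointedArc hα]
    exact le_antisymm (hindep _ (EventStructure.pairwise_independent_enabled _)) hq₅
  · rintro _ ⟨v, rfl⟩
    change {w | (liftedGraph B L).PointedArc α v w}.encard ≤ 5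
    rw [hG.encard_pointedArc hα]
    exact hindep _ (EventStructure.pairwise_independent_enabled _)
  · exact hchrom.trans_le (SimpleGraph.chromaticNumber_mono_of_hom
      ⟨fun b => θ.symm (.box b), fun h => hG.pointedContactGraph_adj hα (hadj _ _ h)⟩)
  · rw [EventStructure.degree_comap]
    apply le_antisymm
    · refine sSup_le ?_
      rintro _ ⟨s, hs, rfl⟩
      exact hindep s hs
    · exact hq₅.trans (le_sSup ⟨_, EventStructure.pairwise_independent_enabled _, rfl⟩)
  · intro A lab hlab
    exact SimpleGraph.lt_encard_range hchrom (fun b => lab (θ.symm (.box b)))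
      (fun b b' h => hlab _ _ ((EventStructure.independent_comap_iff θ).2 (hadj _ _ h)))
      fun b => Set.mem_range_self _
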